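/- Let $2\le k\le\infty$ or $k=\omega$ (analytic), let $\Omega\subset\mathbb R^n$ be open, and let $h:\mathbb R^n\to\mathbb R^p$ be of class $C^{k+1}$ on $\Omega$ and a submersion on $\Omega$, i.e. $\operatorname{rank} dh(x)=p$ for all $x\in\Omega$. Assume that there are given (i) a Riemannian metric $Q$ of class $C^k$ on $\mathbb R^p$ that is complete (every geodesic extends to a geodesic defined on $\mathbb R$) and all of whose geodesics $\mathbb R\to\mathbb R^p$ are minimizing on $\mathbb R$; let $e$ be its Riemannian distance; (ii) for some integer $q\ge 0$, a manifold $\Xi$ of class $C^{k+1}$ and dimension $n-p+q$ with a Riemannian metric $P_\Xi$ of class $C^k$; (iii) a $C^{k+1}$ map $h^\perp:\Omega\to\Xi$ of rank $n-p$ at every point of $\Omega$ such that $\theta=(h,h^\perp):\Omega\to\mathbb R^p\times\Xi$ has rank $n$ at every point of $\Omega$. Let $P=\theta^*(Q\oplus P_\Xi)$ be the pullback to $\Omega$ of the product metric, that is, $$P_x(u,v)=Q_{h(x)}(dh_x u,dh_x v)+(P_\Xi)_{h^\perp(x)}(dh^\perp_x u,dh^\perp_x v).$$ Then: (a) $P$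 is a Riemannian metric of class $C^k$ on $\Omega$. (b) $h:(\Omega,P)\to(\mathbb R^p,Q)$ is a Riemannian submersion: it is a submersion, and $Q_{h(x)}(dh_xv,dh_xv)=P_x(v,v)$ for all $x\in\Omega$ and all $v$ that are $P_x$-orthogonal to $\ker dh_x$. (c) The second fundamental form of $h$ vanishes on $\Omega$: with $\Gamma^c_{ab}$ and $\Delta^i_{jl}$ the Christoffel symbols of $P$ and $Q$, $$\frac{\partial^2h_i}{\partial x_a\partial x_b}(x)-\sum_c\Gamma^c_{ab}(x)\frac{\partial h_i}{\partial x_c}(x)+\sum_{j,l}\Delta^i_{jl}(h(x))\frac{\partial h_j}{\partial x_a}(x)\frac{\partial h_l}{\partial x_b}(x)=0$$ for all $x\in\Omega$ and all $i,a,b$. (d) Condition A3 holds with $\wp(y_1,y_2)=e(y_1,y_2)^2$: the function $\wp:\mathbb R^p\times\mathbb R^p\to[0,\infty)$ is $C^2$; for every $y\in h(\Omega)$ one has $\wp(y,y)=0$ and the second differential of $y_1\mapsto\wp(y_1,y)$ at $y_1=y$ is positive definite; and for every geodesic $\gamma$ of $P$ with values in $\Omega$ that is minimizing on an open interval $(s_1,s_2)$,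 and all $s_3<s_4$ in $(s_1,s_2)$ with $h(\gamma(s_3))\ne h(\gamma(s_4))$, $$\frac{d}{ds}\,\wp\big(h(\gamma(s)),h(\gamma(s_3))\big)>0\qquad\text{for all } s\in(s_3,s_4).$$ Here the Riemannian distance of a metric is the infimum of the lengths of the piecewise $C^1$ paths (lying in $\Omega$ in the case of $P$) between two points, and a geodesic is minimizing on an interval if each of its arcs over a segment of that interval realizes this distance between its end points. -/

import Mathlib

open scoped Manifold ContDiff

/-! ### Riemannian metrics on subsets of `ℝⁿ`, in the standard coordinates

A field of bilinear forms on `ℝⁿ` is a map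
`G : EuclideanSpace ℝ (Fin n) → EuclideanSpace ℝ (Fin n) →L[ℝ] EuclideanSpace ℝ (Fin n) →L[ℝ] ℝ`,
of which only the values on a given open set `U` matter. -/

noncomputable section

namespace RiemObs

/-- `G` is a Riemannian metric of class `C^k` on the (open) set `U`: a symmetric `2`-covariant
tensor field of class `C^k` with positive definite values. -/
structure IsRiemannianMetricOn {n : ℕ} (k : WithTop ℕ∞)
    (G : EuclideanSpace ℝ (Fin n) →
      EuclideanSpace ℝ (Fin n) →L[ℝ] EuclideanSpace ℝ (Fin n) →L[ℝ] ℝ)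
    (U : Set (EuclideanSpace ℝ (Fin n))) : Prop where
  contDiffOn : ContDiffOn ℝ k G U
  symm : ∀ x ∈ U, ∀ u v, G x u v = G x v u
  pos : ∀ x ∈ U, ∀ v, v ≠ 0 → 0 < G x v v

/-- The `a`-th vector of the standard basis of `ℝⁿ`. -/
def stdVec {n : ℕ} (a : Fin n) : EuclideanSpace ℝ (Fin n) := EuclideanSpace.single a 1

/-- The matrix `(G_{ab}(x))` of `G` at `x`. -/
def gram {n : ℕ}
    (G : EuclideanSpace ℝ (Fin n) →
      EuclideanSpace ℝ (Fin n) →L[ℝ] EuclideanSpace ℝ (Fin n) →L[ℝ] ℝ)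
    (x : EuclideanSpace ℝ (Fin n)) : Matrix (Fin n) (Fin n) ℝ :=
  Matrix.of fun a b => G x (stdVec a) (stdVec b)

/-- The partial derivative `∂f/∂x_a` of a real function on `ℝⁿ`. -/
def partialDeriv {n : ℕ} (a : Fin n) (f : EuclideanSpace ℝ (Fin n) → ℝ)
    (x : EuclideanSpace ℝ (Fin n)) : ℝ :=
  fderiv ℝ f x (stdVec a)

/-- The Christoffel symbol `Γ^c_{ab}(x)` of the metric `G`. -/
def christoffel {n : ℕ}
    (G : EuclideanSpace ℝ (Fin n) →
      EuclideanSpace ℝ (Fin n) →L[ℝ] EuclideanSpace ℝ (Fin n) →L[ℝ] ℝ)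
    (x : EuclideanSpace ℝ (Fin n)) (c a b : Fin n) : ℝ :=
  (1 / 2 : ℝ) * ∑ d, (gram G x)⁻¹ c d *
    (partialDeriv b (fun x' => gram G x' a d) x + partialDeriv a (fun x' => gram G x' b d) x
      - partialDeriv d (fun x' => gram G x' a b) x)

/-- `γ`, restricted to the open interval `I` (bounded or not), is a geodesic of the metric `G`
with values in `U`: it is `C²` and satisfies the geodesic equation. Constant curves are allowed. -/
structure IsGeodesicOn {n : ℕ}
    (G : EuclideanSpace ℝ (Fin n) →
      EuclideanSpace ℝ (Fin n) →L[ℝ] EuclideanSpace ℝ (Fin n) →L[ℝ] ℝ)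
    (U : Set (EuclideanSpace ℝ (Fin n))) (γ : ℝ → EuclideanSpace ℝ (Fin n)) (I : Set ℝ) :
    Prop where
  isOpen : IsOpen I
  ordConnected : I.OrdConnected
  mapsTo : Set.MapsTo γ I U
  contDiffOn : ContDiffOn ℝ 2 γ I
  equation : ∀ s ∈ I, ∀ c, deriv (deriv fun t => γ t c) s =
    - ∑ a, ∑ b, christoffel G (γ s) c a b * deriv (fun t => γ t a) s * deriv (fun t => γ t b) s

/-- The length of `γ` between the parameters `a` and `b`. -/
def pathLength {n : ℕ}
    (G : EuclideanSpace ℝ (Fin n) →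
      EuclideanSpace ℝ (Fin n) →L[ℝ] EuclideanSpace ℝ (Fin n) →L[ℝ] ℝ)
    (γ : ℝ → EuclideanSpace ℝ (Fin n)) (a b : ℝ) : ℝ :=
  ∫ s in a..b, Real.sqrt (G (γ s) (deriv γ s) (deriv γ s))

/-- `γ` is a piecewise `C¹` path on `[a, b]`: it is continuous there, and `[a, b]` is cut by
finitely many points into closed intervals on each of which `γ` is `C¹` up to the end points. -/
def IsPiecewiseC1 {n : ℕ} (γ : ℝ → EuclideanSpace ℝ (Fin n)) (a b : ℝ) : Prop :=
  ContinuousOn γ (Set.Icc a b) ∧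
    ∃ (N : ℕ) (t : ℕ → ℝ), Monotone t ∧ t 0 = a ∧ t N = b ∧
      ∀ i < N, ContDiffOn ℝ 1 γ (Set.Icc (t i) (t (i + 1)))

/-- The Riemannian distance of `(U, G)`: the infimum of the lengths of the piecewise `C¹` paths
in `U` from `x` to `y`. -/
def riemDist {n : ℕ}
    (G : EuclideanSpace ℝ (Fin n) →
      EuclideanSpace ℝ (Fin n) →L[ℝ] EuclideanSpace ℝ (Fin n) →L[ℝ] ℝ)
    (U : Set (EuclideanSpace ℝ (Fin n))) (x y : EuclideanSpace ℝ (Fin n)) : ℝ :=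
  sInf {L : ℝ | ∃ (γ : ℝ → EuclideanSpace ℝ (Fin n)) (a b : ℝ), a ≤ b ∧ IsPiecewiseC1 γ a b ∧
    Set.MapsTo γ (Set.Icc a b) U ∧ γ a = x ∧ γ b = y ∧ L = pathLength G γ a b}

/-- `γ` is minimizing on the interval `I`: each of its arcs over a segment of `I` realizes the
Riemannian distance of `(U, G)` between its end points. -/
def IsMinimizingOn {n : ℕ}
    (G : EuclideanSpace ℝ (Fin n) →
      EuclideanSpace ℝ (Fin n) →L[ℝ] EuclideanSpace ℝ (Fin n) →L[ℝ] ℝ)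
    (U : Set (EuclideanSpace ℝ (Fin n))) (γ : ℝ → EuclideanSpace ℝ (Fin n)) (I : Set ℝ) : Prop :=
  ∀ s ∈ I, ∀ s' ∈ I, s ≤ s' → pathLength G γ s s' = riemDist G U (γ s) (γ s')

/-- The metric `G` on the whole of `ℝⁿ` is (geodesically) complete: every geodesic extends to a
geodesic defined on `ℝ`. -/
def IsCompleteMetric {n : ℕ}
    (G : EuclideanSpace ℝ (Fin n) →
      EuclideanSpace ℝ (Fin n) →L[ℝ] EuclideanSpace ℝ (Fin n) →L[ℝ] ℝ) : Prop :=
  ∀ (γ : ℝ → EuclideanSpace ℝ (Fin n)) (I : Set ℝ), I.Nonempty → IsGeodesicOn G Set.univ γ I →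
    ∃ γ' : ℝ → EuclideanSpace ℝ (Fin n), IsGeodesicOn G Set.univ γ' Set.univ ∧ Set.EqOn γ' γ I

/-- Complete metrics on `ℝᵖ` all of whose geodesics `ℝ → ℝᵖ` are minimizing on `ℝ`. -/
structure IsCompleteWithMinimizingGeodesics {p : ℕ}
    (Q : EuclideanSpace ℝ (Fin p) →
      EuclideanSpace ℝ (Fin p) →L[ℝ] EuclideanSpace ℝ (Fin p) →L[ℝ] ℝ) : Prop where
  complete : IsCompleteMetric Q
  minimizing : ∀ δ : ℝ → EuclideanSpace ℝ (Fin p),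
    IsGeodesicOn Q Set.univ δ Set.univ → IsMinimizingOn Q Set.univ δ Set.univ

/-! ### Maps between Riemannian manifolds -/

/-- `h` is a submersion at the points of `Ω`: its differential has rank `p`. -/
def IsSubmersionOn {n p : ℕ} (h : EuclideanSpace ℝ (Fin n) → EuclideanSpace ℝ (Fin p))
    (Ω : Set (EuclideanSpace ℝ (Fin n))) : Prop :=
  ∀ x ∈ Ω, Module.finrank ℝ (fderiv ℝ h x).range = p

/-- The `P`-orthogonal complement of the tangent space `ker dh(x)` of the level set of `h`. -/
def orthogonalDistribution {n p : ℕ}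
    (P : EuclideanSpace ℝ (Fin n) →
      EuclideanSpace ℝ (Fin n) →L[ℝ] EuclideanSpace ℝ (Fin n) →L[ℝ] ℝ)
    (h : EuclideanSpace ℝ (Fin n) → EuclideanSpace ℝ (Fin p)) (x : EuclideanSpace ℝ (Fin n)) :
    Set (EuclideanSpace ℝ (Fin n)) :=
  {v | ∀ u, fderiv ℝ h x u = 0 → P x u v = 0}

/-- `h : (Ω, P) → (ℝᵖ, Q)` is a Riemannian submersion: a submersion whose differential preserves
the length of the vectors orthogonal to its level sets. -/
def IsRiemannianSubmersionOn {n p : ℕ}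
    (P : EuclideanSpace ℝ (Fin n) →
      EuclideanSpace ℝ (Fin n) →L[ℝ] EuclideanSpace ℝ (Fin n) →L[ℝ] ℝ)
    (Q : EuclideanSpace ℝ (Fin p) →
      EuclideanSpace ℝ (Fin p) →L[ℝ] EuclideanSpace ℝ (Fin p) →L[ℝ] ℝ)
    (h : EuclideanSpace ℝ (Fin n) → EuclideanSpace ℝ (Fin p))
    (Ω : Set (EuclideanSpace ℝ (Fin n))) : Prop :=
  IsSubmersionOn h Ω ∧ ∀ x ∈ Ω, ∀ v ∈ orthogonalDistribution P h x,
    Q (h x) (fderiv ℝ h x v) (fderiv ℝ h x v) = P x v v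

/-- The component `II_P h^i_{ab}(x)` of the second fundamental form of `h : (ℝⁿ, P) → (ℝᵖ, Q)`,
in the standard coordinates. -/
def secondFundamentalForm {n p : ℕ}
    (P : EuclideanSpace ℝ (Fin n) →
      EuclideanSpace ℝ (Fin n) →L[ℝ] EuclideanSpace ℝ (Fin n) →L[ℝ] ℝ)
    (Q : EuclideanSpace ℝ (Fin p) →
      EuclideanSpace ℝ (Fin p) →L[ℝ] EuclideanSpace ℝ (Fin p) →L[ℝ] ℝ)
    (h : EuclideanSpace ℝ (Fin n) → EuclideanSpace ℝ (Fin p))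
    (x : EuclideanSpace ℝ (Fin n)) (i : Fin p) (a b : Fin n) : ℝ :=
  partialDeriv a (partialDeriv b fun x' => h x' i) x
    - ∑ c, christoffel P x c a b * partialDeriv c (fun x' => h x' i) x
    + ∑ j, ∑ l, christoffel Q (h x) i j l *
        partialDeriv a (fun x' => h x' j) x * partialDeriv b (fun x' => h x' l) x

/-- Condition A3 for the output map `h`, the metric `P` on `Ω`, and the function `w` (written `℘`
in the literature).

In `monotone`, `I` ranges over all the open intervals on which `γ` is a minimizing geodesic in
`Ω`, the maximal ones among them. -/
structure ConditionA3 {n p : ℕ}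
    (P : EuclideanSpace ℝ (Fin n) →
      EuclideanSpace ℝ (Fin n) →L[ℝ] EuclideanSpace ℝ (Fin n) →L[ℝ] ℝ)
    (Ω : Set (EuclideanSpace ℝ (Fin n)))
    (h : EuclideanSpace ℝ (Fin n) → EuclideanSpace ℝ (Fin p))
    (w : EuclideanSpace ℝ (Fin p) → EuclideanSpace ℝ (Fin p) → ℝ) : Prop where
  contDiff : ContDiff ℝ 2 fun y : EuclideanSpace ℝ (Fin p) × EuclideanSpace ℝ (Fin p) => w y.1 y.2
  nonneg : ∀ y₁ y₂, 0 ≤ w y₁ y₂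
  eq_zero : ∀ y ∈ h '' Ω, w y y = 0
  hessian_pos : ∀ y ∈ h '' Ω, ∀ v, v ≠ 0 → 0 < fderiv ℝ (fderiv ℝ fun y₁ => w y₁ y) y v v
  monotone : ∀ (γ : ℝ → EuclideanSpace ℝ (Fin n)) (I : Set ℝ),
    IsGeodesicOn P Ω γ I → IsMinimizingOn P Ω γ I →
      ∀ s₃ ∈ I, ∀ s₄ ∈ I, s₃ < s₄ → h (γ s₃) ≠ h (γ s₄) →
        ∀ s ∈ Set.Ioo s₃ s₄, 0 < deriv (fun t => w (h (γ t)) (h (γ s₃))) s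

/-! ### The pullback of a product metric -/

/-- The product metric `Q ⊕ R` on `ℝᵖ × Ξ`; the tangent space of `ℝᵖ × Ξ` at a point is the model
space `ℝᵖ × ℝᵐ`. -/
def productMetric {p m : ℕ} {k : WithTop ℕ∞} {Ξ : Type*} [TopologicalSpace Ξ]
    [ChartedSpace (EuclideanSpace ℝ (Fin m)) Ξ] [IsManifold (𝓡 m) 1 Ξ]
    (Q : EuclideanSpace ℝ (Fin p) →
      EuclideanSpace ℝ (Fin p) →L[ℝ] EuclideanSpace ℝ (Fin p) →L[ℝ] ℝ)
    (R : Bundle.ContMDiffRiemannianMetric (𝓡 m) k (EuclideanSpace ℝ (Fin m))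
      (TangentSpace (𝓡 m) : Ξ → Type))
    (z : EuclideanSpace ℝ (Fin p) × Ξ) :
    (EuclideanSpace ℝ (Fin p) × EuclideanSpace ℝ (Fin m)) →L[ℝ]
      (EuclideanSpace ℝ (Fin p) × EuclideanSpace ℝ (Fin m)) →L[ℝ] ℝ :=
  let Rz : EuclideanSpace ℝ (Fin m) →L[ℝ] EuclideanSpace ℝ (Fin m) →L[ℝ] ℝ := R.inner z.2
  (Q z.1).bilinearComp (ContinuousLinearMap.fst ℝ _ _) (ContinuousLinearMap.fst ℝ _ _)
    + Rz.bilinearComp (ContinuousLinearMap.snd ℝ _ _) (ContinuousLinearMap.snd ℝ _ _)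

/-- The pullback `(u, v) ↦ G_{θ(x)}(dθ(x) u, dθ(x) v)` via `θ : ℝⁿ → ℝᵖ × Ξ` of a field `G` of
bilinear forms on `ℝᵖ × Ξ`. -/
def pullbackMetric {n p m : ℕ} {Ξ : Type*} [TopologicalSpace Ξ]
    [ChartedSpace (EuclideanSpace ℝ (Fin m)) Ξ]
    (θ : EuclideanSpace ℝ (Fin n) → EuclideanSpace ℝ (Fin p) × Ξ)
    (G : EuclideanSpace ℝ (Fin p) × Ξ →
      (EuclideanSpace ℝ (Fin p) × EuclideanSpace ℝ (Fin m)) →L[ℝ]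
        (EuclideanSpace ℝ (Fin p) × EuclideanSpace ℝ (Fin m)) →L[ℝ] ℝ)
    (x : EuclideanSpace ℝ (Fin n)) :
    EuclideanSpace ℝ (Fin n) →L[ℝ] EuclideanSpace ℝ (Fin n) →L[ℝ] ℝ :=
  let D : EuclideanSpace ℝ (Fin n) →L[ℝ] EuclideanSpace ℝ (Fin p) × EuclideanSpace ℝ (Fin m) :=
    mfderiv (𝓡 n) ((𝓡 p).prod (𝓡 m)) θ x
  (G (θ x)).bilinearComp D D

end RiemObs

end

open scoped Manifold ContDiff

noncomputable section

namespace RiemObs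

open Set Filter Topology

/-! ### Dependence of the solutions of differential equations on the initial value -/

section Flow

variable {E : Type*} [NormedAddCommGroup E] [NormedSpace ℝ E]

/-! The proof has two independent halves: an algebraic one on `P`, and a metric one on `Q` alone.

In a chart of `Ξ` around a value of `hperp`, the metric is `P = h^*Q + g^*R` with `g` the chart
expression of `hperp` (`exists_isLocalProduct`). Joint injectivity of `dh`, `dg` and the ranks `p`
and `n - p` force `dh` to map `ker dg` onto `ℝᵖ` and `dg` to map `ker dh` onto the range of `dg`
(`exists_ker_apply_eq`). The second fact gives the Riemannian submersion. For the second fundamental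
form, the Christoffel symbols of the first kind of a pullback `f^*G` are the pulled back ones plus
`G(D²f(u,v), df w)`. Testing `P` against `w ∈ ker dg` removes everything that comes from `g`, and
since `dh w` is then arbitrary, `dh Γ_P = D²h + Γ_Q(dh, dh)` (`IsLocalProduct.chrVec_eq`).
Consequently `h` sends geodesics of `P` to geodesics of `Q`, which reduces Condition A3 to
statements about `Q`.

Completeness gives `Q` a global geodesic flow `φ`; for a `C²` metric it is only `C¹`
(`IsFlow.contDiff`). Since geodesics minimize, the squared distance between `y` and `exp_y v` is
`Q_y(v, v)`. The crux is that `(y, v) ↦ (y, exp_y v)` is a `C¹` diffeomorphism, and this is shown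
without Jacobi fields. Varying the energy bounds the squared distance above to second order near the
end of a geodesic; prolonging the geodesic to time `2` and using the triangle inequality bounds it
below (`exists_sq_riemDist_expansion`). The final velocity is thus determined by the end points,
which yields injectivity, and an infinitesimal version shows that the differential is injective. An
open-closed argument gives surjectivity.

Composing the energy with the inverse diffeomorphism makes the squared distance `C¹` only. The
missing derivative comes from the first variation formula: the differential is itself a `C¹`
expression in the initial state (`exists_hasFDerivAt_sq_riemDist`). The Hessian and the monotonicity
both follow from the explicit value `t² Q_y(v, v)` along geodesics from `y`. -/

/-- Pointwise application of a continuous family of linear maps to a continuous function. -/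
def pointwiseApply (K E : Type*) [TopologicalSpace K] [CompactSpace K]
    [NormedAddCommGroup E] [NormedSpace ℝ E] : C(K, E →L[ℝ] E) →L[ℝ] C(K, E) →L[ℝ] C(K, E) :=
  LinearMap.mkContinuous₂
    (LinearMap.mk₂ ℝ (fun (A : C(K, E →L[ℝ] E)) (w : C(K, E)) =>
        (⟨fun t => A t (w t), by fun_prop⟩ : C(K, E)))
      (fun A B w => by ext t; simp) (fun c A w => by ext t; simp)
      (fun A w z => by ext t; simp) (fun c A w => by ext t; simp)) 1
    (fun A w => by
      rw [ContinuousMap.norm_le _ (by positivity)]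
      intro t
      rw [one_mul]
      exact (A t).le_of_opNorm_le_of_le (A.norm_coe_le_norm t) (w.norm_coe_le_norm t))

/-- The superposition operator `u ↦ X ∘ u` of a `C¹` map `X` is `C¹` on spaces of continuous
functions on a compact space. -/
lemma contDiff_superposition {K : Type*} [TopologicalSpace K] [CompactSpace K] {X : E → E}
    (hX : ContDiff ℝ 1 X) :
    ContDiff ℝ 1 fun u : C(K, E) => (⟨X, hX.continuous⟩ : C(E, E)).comp u := by
  have hX' : Continuous (fderiv ℝ X) := hX.continuous_fderiv one_ne_zero
  have hcont : Continuous fun u : C(K, E) =>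
      (⟨fderiv ℝ X, hX'⟩ : C(E, E →L[ℝ] E)).comp u := ContinuousMap.continuous_postcomp _
  rw [contDiff_one_iff_hasFDerivAt]
  refine ⟨fun u => pointwiseApply K E ((⟨fderiv ℝ X, hX'⟩ : C(E, E →L[ℝ] E)).comp u),
    (pointwiseApply K E).continuous.comp hcont, fun u => ?_⟩
  rw [hasFDerivAt_iff_isLittleO_nhds_zero, Asymptotics.isLittleO_iff]
  intro c hc
  obtain ⟨δ, hδ, hball⟩ := (Metric.continuousAt_iff (α := C(K, E)) (β := C(K, E →L[ℝ] E))).1 (hcont.continuousAt (x := u)) c hc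
  filter_upwards [Metric.ball_mem_nhds (0 : C(K, E)) hδ] with w hw
  rw [mem_ball_zero_iff] at hw
  rw [ContinuousMap.norm_le _ (by positivity)]
  intro t
  -- The mean value inequality on the segment from `u t` to `u t + w t`, pointwise in `t`. The bound
  -- `c` on the variation of `fderiv ℝ X` is uniform in `t` because composition is continuous in the
  -- sup norm.
  have key := (convex_segment (𝕜 := ℝ) (u t) (u t + w t)).norm_image_sub_le_of_norm_fderiv_le'
    (f := X) (φ := fderiv ℝ X (u t)) (C := c)
    (fun x _ => hX.differentiable one_ne_zero x) ?_ (left_mem_segment ..) (right_mem_segment ..)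
  · simp only [add_sub_cancel_left] at key
    refine le_trans key ?_
    gcongr
    exact w.norm_coe_le_norm t
  · intro x hx
    rw [segment_eq_image'] at hx
    obtain ⟨θ, hθ, rfl⟩ := hx
    have h1 : dist (u + θ • w) u < δ := by
      rw [dist_eq_norm, add_sub_cancel_left, norm_smul, Real.norm_eq_abs, abs_of_nonneg hθ.1]
      exact lt_of_le_of_lt (mul_le_of_le_one_left (norm_nonneg _) hθ.2) hw
    have h2 := (ContinuousMap.dist_lt_iff hc).1 (hball h1) t
    rw [dist_eq_norm] at h2
    simpa using h2.le

/-- Integration from `0` as a bounded operator on `C([0, 1], E)`. -/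
def integralOperator (E : Type*) [NormedAddCommGroup E] [NormedSpace ℝ E] [CompleteSpace E] :
    C(Icc (0 : ℝ) 1, E) →L[ℝ] C(Icc (0 : ℝ) 1, E) :=
  LinearMap.mkContinuous
    { toFun := fun u => ⟨fun t => ∫ s in (0 : ℝ)..t, u (projIcc 0 1 zero_le_one s), by
        have hc : Continuous fun s : ℝ => u (projIcc 0 1 zero_le_one s) :=
          u.continuous.comp continuous_projIcc
        exact (intervalIntegral.continuous_primitive
          (fun a b => hc.intervalIntegrable a b) 0).comp continuous_subtype_val⟩
      map_add' := fun u v => by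
        ext t
        have hc : ∀ u : C(Icc (0 : ℝ) 1, E), Continuous fun s : ℝ => u (projIcc 0 1 zero_le_one s) :=
          fun u => u.continuous.comp continuous_projIcc
        exact intervalIntegral.integral_add ((hc u).intervalIntegrable _ _)
          ((hc v).intervalIntegrable _ _)
      map_smul' := fun c u => by
        ext t
        exact intervalIntegral.integral_smul _ _ } 1
    (fun u => by
      rw [ContinuousMap.norm_le _ (by positivity)]
      intro t
      have h := intervalIntegral.norm_integral_le_of_norm_le_const (a := 0) (b := (t : ℝ))
        (f := fun s => u (projIcc 0 1 zero_le_one s)) (C := ‖u‖)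
        (fun s _ => u.norm_coe_le_norm _)
      refine h.trans ?_
      rw [sub_zero, abs_of_nonneg t.2.1, mul_comm]
      gcongr
      exact t.2.2)

variable [FiniteDimensional ℝ E]


lemma exists_lipschitzOnWith_closedBall {F : Type*} [NormedAddCommGroup F] [NormedSpace ℝ F]
    {X : E → F} (hX : ContDiff ℝ 1 X) (r : ℝ) :
    ∃ K, LipschitzOnWith K X (Metric.closedBall 0 r) :=
  (hX.locallyLipschitz.locallyLipschitzOn).exists_lipschitzOnWith_of_compact
    (isCompact_closedBall 0 r)

/-- On a compact time interval both curves stay in one closed ball, where a `C¹` field is Lipschitz,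
so Grönwall uniqueness applies without a global Lipschitz bound. -/
lemma integralCurve_eqOn_Icc {X : E → E} (hX : ContDiff ℝ 1 X) {f g : ℝ → E} {T : ℝ}
    (hf : ∀ t ∈ Icc 0 T, HasDerivAt f (X (f t)) t) (hg : ∀ t ∈ Icc 0 T, HasDerivAt g (X (g t)) t)
    (h0 : f 0 = g 0) : EqOn f g (Icc 0 T) := by
  have hfc : ContinuousOn f (Icc 0 T) := fun t ht => (hf t ht).continuousAt.continuousWithinAt
  have hgc : ContinuousOn g (Icc 0 T) := fun t ht => (hg t ht).continuousAt.continuousWithinAt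
  obtain ⟨r₁, hr₁⟩ := (isCompact_Icc.image_of_continuousOn hfc).isBounded.subset_closedBall 0
  obtain ⟨r₂, hr₂⟩ := (isCompact_Icc.image_of_continuousOn hgc).isBounded.subset_closedBall 0
  obtain ⟨K, hK⟩ := exists_lipschitzOnWith_closedBall hX (max r₁ r₂)
  refine ODE_solution_unique_of_mem_Icc_right (v := fun _ => X)
    (s := fun _ => Metric.closedBall 0 (max r₁ r₂)) (fun _ _ => hK) hfc
    (fun t ht => (hf t (Ico_subset_Icc_self ht)).hasDerivWithinAt)
    (fun t ht => ?_) hgc (fun t ht => (hg t (Ico_subset_Icc_self ht)).hasDerivWithinAt)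
    (fun t ht => ?_) h0
  · exact Metric.closedBall_subset_closedBall (le_max_left _ _)
      (hr₁ (mem_image_of_mem _ (Ico_subset_Icc_self ht)))
  · exact Metric.closedBall_subset_closedBall (le_max_right _ _)
      (hr₂ (mem_image_of_mem _ (Ico_subset_Icc_self ht)))

lemma integralCurve_unique {X : E → E} (hX : ContDiff ℝ 1 X) {f g : ℝ → E}
    (hf : ∀ t, HasDerivAt f (X (f t)) t) (hg : ∀ t, HasDerivAt g (X (g t)) t)
    (h0 : f 0 = g 0) : f = g := by
  funext t
  rcases le_total 0 t with ht | ht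
  · exact integralCurve_eqOn_Icc hX (fun s _ => hf s) (fun s _ => hg s) h0 (right_mem_Icc.2 ht)
  · have hneg : ∀ {f : ℝ → E}, (∀ t, HasDerivAt f (X (f t)) t) →
        ∀ t, HasDerivAt (fun s => f (-s)) (-X (f (-t))) t := by
      intro f hf t
      have h := (hf (-t)).scomp t (hasDerivAt_neg t)
      rwa [neg_one_smul] at h
    have := integralCurve_eqOn_Icc hX.neg (T := -t) (fun s _ => hneg hf s) (fun s _ => hneg hg s)
      (by simpa using h0) (right_mem_Icc.2 (neg_nonneg.2 ht))
    simpa using this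

/-- A global flow of the vector field `X`. -/
structure IsFlow (X : E → E) (φ : ℝ → E → E) : Prop where
  zero : ∀ x, φ 0 x = x
  hasDerivAt : ∀ x t, HasDerivAt (fun s => φ s x) (X (φ t x)) t

lemma IsFlow.add {X : E → E} {φ : ℝ → E → E} (hφ : IsFlow X φ) (hX : ContDiff ℝ 1 X)
    (s t : ℝ) (x : E) : φ (s + t) x = φ s (φ t x) := by
  have h : (fun s => φ (s + t) x) = fun s => φ s (φ t x) := by
    refine integralCurve_unique hX (fun s => ?_) (fun s => hφ.hasDerivAt _ s) ?_
    · exact (hφ.hasDerivAt x (s + t)).comp_add_const s t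
    · simp [hφ.zero]
  exact congrFun h s

/-- The rescaled curve `t ↦ φ (ε t) x` solves `u = x + ε ∫ X(u)` in `C([0,1], E)`. This equation is
`C¹` in `(ε, x, u)`, and at `ε = 0` its derivative in `u` is the identity, so the implicit function
theorem gives a `C¹` solution; its value at `t = 1` is `φ ε x`. -/
lemma IsFlow.contDiffAt_zero {X : E → E} {φ : ℝ → E → E} (hφ : IsFlow X φ) (hX : ContDiff ℝ 1 X)
    (x₀ : E) : ContDiffAt ℝ 1 (fun q : ℝ × E => φ q.1 q.2) (0, x₀) := by
  have := FiniteDimensional.complete ℝ E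
  let C := C(Icc (0 : ℝ) 1, E)
  let cst : E →L[ℝ] C := ContinuousLinearMap.const ℝ (Icc (0 : ℝ) 1)
  let N : C → C := fun u => (⟨X, hX.continuous⟩ : C(E, E)).comp u
  have hN : ContDiff ℝ 1 N := contDiff_superposition hX
  let G : (ℝ × E) × C → C := fun q => q.2 - cst q.1.2 - q.1.1 • integralOperator E (N q.2)
  have hG : ContDiff ℝ 1 G := by
    have h1 : ContDiff ℝ 1 fun q : (ℝ × E) × C => integralOperator E (N q.2) :=
      (integralOperator E).contDiff.comp (hN.comp contDiff_snd)
    have h2 : ContDiff ℝ 1 fun q : (ℝ × E) × C => cst q.1.2 :=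
      cst.contDiff.comp (contDiff_snd.comp contDiff_fst)
    exact (contDiff_snd.sub h2).sub ((contDiff_fst.comp contDiff_fst).smul h1)
  let q₀ : (ℝ × E) × C := ((0, x₀), cst x₀)
  have hinr : fderiv ℝ G q₀ ∘L ContinuousLinearMap.inr ℝ (ℝ × E) C = ContinuousLinearMap.id ℝ C := by
    have h1 : HasFDerivAt G (fderiv ℝ G q₀) q₀ :=
      (hG.differentiable one_ne_zero q₀).hasFDerivAt
    have h2 : HasFDerivAt (fun u : C => (((0 : ℝ), x₀), u)) (ContinuousLinearMap.inr ℝ (ℝ × E) C)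
        (cst x₀) := hasFDerivAt_prodMk_right _ _
    have h3 := HasFDerivAt.comp (cst x₀) h1 h2
    have h4 : HasFDerivAt (fun u : C => u - cst x₀) (ContinuousLinearMap.id ℝ C) (cst x₀) :=
      (hasFDerivAt_id _).sub_const _
    refine h3.unique (h4.congr_of_eventuallyEq (Eventually.of_forall fun u => ?_))
    simp [G]
  have hinv : (fderiv ℝ G q₀ ∘L ContinuousLinearMap.inr ℝ (ℝ × E) C).IsInvertible := by
    rw [hinr]
    exact ⟨ContinuousLinearEquiv.refl ℝ C, rfl⟩
  let ψ := hG.contDiffAt.implicitFunction (u := q₀) one_ne_zero hinv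
  have hψ : ContDiffAt ℝ 1 ψ (0, x₀) := hG.contDiffAt.contDiffAt_implicitFunction one_ne_zero hinv
  have hψG : ∀ᶠ q in 𝓝 ((0 : ℝ), x₀), G (q, ψ q) = G q₀ :=
    hG.contDiffAt.eventually_apply_implicitFunction (u := q₀) one_ne_zero hinv
  have hG0 : G q₀ = 0 := by simp [G, q₀]
  let ev : C →L[ℝ] E := ContinuousMap.evalCLM ℝ (⟨1, by simp⟩ : Icc (0 : ℝ) 1)
  refine (ev.contDiff.contDiffAt.comp _ hψ).congr_of_eventuallyEq ?_
  filter_upwards [hψG] with q hq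
  obtain ⟨ε, x⟩ := q
  rw [hG0] at hq
  set u : C := ψ (ε, x) with hu
  have hcont : Continuous fun s : ℝ => X (u (projIcc 0 1 zero_le_one s)) :=
    hX.continuous.comp (u.continuous.comp continuous_projIcc)
  -- The right-hand side of the fixed-point equation, defined on all of `ℝ` so that it has two-sided
  -- derivatives at the ends of `[0,1]`; it equals `u` there.
  let U : ℝ → E := fun t => x + ε • ∫ s in (0 : ℝ)..t, X (u (projIcc 0 1 zero_le_one s))
  have hU : ∀ t : Icc (0 : ℝ) 1, U t = u t := by
    intro t
    have h1 := congrArg (fun f : C => f t) hq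
    have h2 : u t - x - ε • (∫ s in (0 : ℝ)..t, X (u (projIcc 0 1 zero_le_one s))) = 0 := h1
    rw [sub_sub, sub_eq_zero] at h2
    exact h2.symm
  have hderiv : ∀ t ∈ Icc (0 : ℝ) 1, HasDerivAt U ((ε • X) (U t)) t := by
    intro t ht
    have h1 := ((intervalIntegral.integral_hasDerivAt_right (hcont.intervalIntegrable 0 t)
      hcont.stronglyMeasurable.stronglyMeasurableAtFilter hcont.continuousAt).const_smul ε).const_add x
    have h2 : (ε • X) (U t) = ε • X (u (projIcc 0 1 zero_le_one t)) := by
      rw [projIcc_of_mem _ ht, ← hU ⟨t, ht⟩]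
      rfl
    rw [h2]
    exact h1
  have hderiv' : ∀ t ∈ Icc (0 : ℝ) 1, HasDerivAt (fun t => φ (ε * t) x) ((ε • X) (φ (ε * t) x)) t := by
    intro t _
    have h1 : HasDerivAt (fun t : ℝ => ε * t) ε t := by simpa using (hasDerivAt_id t).const_mul ε
    exact (hφ.hasDerivAt x (ε * t)).scomp t h1
  have h1 := integralCurve_eqOn_Icc (hX.const_smul ε) hderiv' hderiv (by simp [U, hφ.zero])
    (right_mem_Icc.2 zero_le_one)
  have h2 := hU ⟨1, by simp⟩
  simp only [mul_one] at h1
  exact h1.trans h2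

/-- The flow of a `C¹` vector field is of class `C¹` in the time and the initial value. -/
theorem IsFlow.contDiff {X : E → E} {φ : ℝ → E → E} (hφ : IsFlow X φ) (hX : ContDiff ℝ 1 X) :
    ContDiff ℝ 1 (fun q : ℝ × E => φ q.1 q.2) := by
  rw [contDiff_iff_contDiffAt]
  rintro ⟨t₁, x⟩
  have hcont : Continuous fun t => φ t x :=
    continuous_iff_continuousAt.2 fun t => (hφ.hasDerivAt x t).continuousAt
  let S : Set ℝ := {t | ContDiffAt ℝ 1 (fun q : ℝ × E => φ q.1 q.2) (t, x)}
  have hopen : IsOpen S := by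
    rw [isOpen_iff_mem_nhds]
    intro t ht
    have h1 : Tendsto (fun s : ℝ => (s, x)) (𝓝 t) (𝓝 (t, x)) := by
      apply Continuous.tendsto'
      · fun_prop
      · rfl
    exact h1.eventually (ContDiffAt.eventually ht (by simp))
  -- For `s ∈ S` close to the limit time `t`, the flow is `C¹` at `(t - s, φ s x)`, a point near
  -- `(0, φ t x)`, and the group law factors `φ` near `(t, x)` through `φ s`.
  have hclosed : IsClosed S := by
    rw [← closure_subset_iff_isClosed]
    intro t ht
    have h1 := (hφ.contDiffAt_zero hX (φ t x)).eventually (by simp)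
    have h2 : Tendsto (fun s : ℝ => (t - s, φ s x)) (𝓝 t) (𝓝 (0, φ t x)) := by
      apply Continuous.tendsto'
      · fun_prop
      · simp
    obtain ⟨s, hs, hsS⟩ := mem_closure_iff_nhds.1 ht _ (h2.eventually h1)
    have hs' : ContDiffAt ℝ 1 (fun q : ℝ × E => φ q.1 q.2) (t - s, φ s x) := hs
    have h3 : ContDiffAt ℝ 1 (fun q : ℝ × E => (q.1 - s, φ s q.2)) (t, x) := by
      refine (contDiffAt_fst.sub contDiffAt_const).prodMk ?_
      have h4 : ContDiffAt ℝ 1 (fun q : ℝ × E => (s, q.2)) (t, x) :=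
        contDiffAt_const.prodMk contDiffAt_snd
      exact ContDiffAt.comp (t, x) (g := fun q : ℝ × E => φ q.1 q.2)
        (f := fun q : ℝ × E => (s, q.2)) hsS h4
    have h5 := ContDiffAt.comp (t, x) (g := fun q : ℝ × E => φ q.1 q.2)
      (f := fun q : ℝ × E => (q.1 - s, φ s q.2)) hs' h3
    refine h5.congr_of_eventuallyEq (Eventually.of_forall fun q => ?_)
    simp [← hφ.add hX]
  have hne : (0 : ℝ) ∈ S := hφ.contDiffAt_zero hX x
  have := IsClopen.eq_univ ⟨hclosed, hopen⟩ ⟨0, hne⟩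
  exact (this ▸ mem_univ t₁ : t₁ ∈ S)

end Flow

/-- Euclidean space of dimension `n`. -/
abbrev Euc (n : ℕ) := EuclideanSpace ℝ (Fin n)

/-- Fields of bilinear forms on `ℝⁿ`. -/
abbrev BilinField (n : ℕ) := Euc n → Euc n →L[ℝ] Euc n →L[ℝ] ℝ

/-! ### Christoffel symbols -/

section Christoffel

variable {n : ℕ}

lemma sum_smul_stdVec (u : Euc n) : ∑ a, u a • stdVec a = u := by
  ext i
  simp [stdVec, Pi.single_apply]

lemma eq_of_isLinearMap {F : Type*} [AddCommGroup F] [Module ℝ F] {f g : Euc n → F}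
    (hf : IsLinearMap ℝ f) (hg : IsLinearMap ℝ g)
    (h : ∀ a, f (stdVec a) = g (stdVec a)) (u : Euc n) : f u = g u := by
  have key : ∀ {f : Euc n → F}, IsLinearMap ℝ f → f u = ∑ a, u a • f (stdVec a) := by
    intro f hf
    conv_lhs => rw [← sum_smul_stdVec u]
    have := map_sum hf.mk' (fun a => u a • stdVec a) Finset.univ
    simp only [IsLinearMap.mk'_apply, hf.map_smul] at this
    exact this
  rw [key hf, key hg]
  simp [h]

/-- The vector `Γ(u, v)` formed with the Christoffel symbols of `G` at `x`. -/
def chrVec (G : BilinField n) (x u v : Euc n) : Euc n :=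
  WithLp.toLp 2 fun c => ∑ a, ∑ b, christoffel G x c a b * u a * v b

lemma chrVec_apply (G : BilinField n) (x u v : Euc n) (c : Fin n) :
    chrVec G x u v c = ∑ a, ∑ b, christoffel G x c a b * u a * v b := rfl

lemma chrVec_stdVec (G : BilinField n) (x : Euc n) (a b c : Fin n) :
    chrVec G x (stdVec a) (stdVec b) c = christoffel G x c a b := by
  simp [chrVec_apply, stdVec, PiLp.single_apply]

lemma isLinearMap_chrVec_left (G : BilinField n) (x v : Euc n) :
    IsLinearMap ℝ fun u => chrVec G x u v where
  map_add u u' := by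
    ext c
    simp [chrVec_apply, mul_add, add_mul, Finset.sum_add_distrib]
  map_smul r u := by
    ext c
    simp only [chrVec_apply, PiLp.smul_apply, smul_eq_mul, Finset.mul_sum]
    exact Finset.sum_congr rfl fun a _ => Finset.sum_congr rfl fun b _ => by ring

lemma isLinearMap_chrVec_right (G : BilinField n) (x u : Euc n) :
    IsLinearMap ℝ fun v => chrVec G x u v where
  map_add u u' := by
    ext c
    simp [chrVec_apply, mul_add, Finset.sum_add_distrib]
  map_smul r u := by
    ext c
    simp only [chrVec_apply, PiLp.smul_apply, smul_eq_mul, Finset.mul_sum]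
    exact Finset.sum_congr rfl fun a _ => Finset.sum_congr rfl fun b _ => by ring

/-- The Christoffel symbols of the first kind. -/
def firstKind (G : BilinField n) (x u v w : Euc n) : ℝ :=
  (1 / 2 : ℝ) * (fderiv ℝ G x v u w + fderiv ℝ G x u v w - fderiv ℝ G x w u v)

lemma partialDeriv_gram {G : BilinField n} {x : Euc n} (hG : DifferentiableAt ℝ G x)
    (a b d : Fin n) : partialDeriv b (fun x' => gram G x' a d) x =
      fderiv ℝ G x (stdVec b) (stdVec a) (stdVec d) := by
  have h := (hG.hasFDerivAt.clm_apply (hasFDerivAt_const (stdVec a) x)).clm_apply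
    (hasFDerivAt_const (stdVec d) x)
  simp only [partialDeriv, gram, Matrix.of_apply]
  rw [h.fderiv]
  simp

lemma isUnit_det_gram {G : BilinField n} {x : Euc n} (hpos : ∀ v, v ≠ 0 → 0 < G x v v) :
    IsUnit (gram G x).det := by
  rw [isUnit_iff_ne_zero]
  intro hdet
  obtain ⟨v, hv, hv0⟩ := Matrix.exists_mulVec_eq_zero_iff.2 hdet
  have hlin : ∀ u, G x u (WithLp.toLp 2 v) = 0 := by
    refine eq_of_isLinearMap (g := fun _ => 0) ⟨by simp, by simp⟩ ⟨by simp, by simp⟩ fun a => ?_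
    have h1 := congrFun hv0 a
    rw [Pi.zero_apply] at h1
    rw [← sum_smul_stdVec (WithLp.toLp 2 v), map_sum]
    simp only [map_smul, smul_eq_mul]
    rw [← h1]
    simp only [Matrix.mulVec, dotProduct, gram, Matrix.of_apply]
    exact Finset.sum_congr rfl fun b _ => by ring
  refine (hpos (WithLp.toLp 2 v) fun h => hv ?_).ne' (hlin _)
  simpa using h

/-- The characterization of the Christoffel symbols. -/
lemma apply_chrVec {G : BilinField n} {x : Euc n} (hG : DifferentiableAt ℝ G x)
    (hsymm : ∀ u v, G x u v = G x v u) (hpos : ∀ v, v ≠ 0 → 0 < G x v v) (u v w : Euc n) :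
    G x (chrVec G x u v) w = firstKind G x u v w := by
  -- Both sides are linear in each of `w`, `v`, `u`, so basis vectors suffice; there the claim is
  -- that the Gram matrix times its inverse is the identity.
  refine eq_of_isLinearMap (f := fun w => G x (chrVec G x u v) w)
    (g := fun w => firstKind G x u v w) ⟨by simp, by simp⟩
    ⟨fun _ _ => by simp [firstKind]; ring, fun _ _ => by simp [firstKind]; ring⟩ (fun d => ?_) w
  refine eq_of_isLinearMap (f := fun v => G x (chrVec G x u v) (stdVec d))
    (g := fun v => firstKind G x u v (stdVec d))
    ⟨fun _ _ => by simp [(isLinearMap_chrVec_right G x u).map_add],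
      fun _ _ => by simp [(isLinearMap_chrVec_right G x u).map_smul]⟩
    ⟨fun _ _ => by simp [firstKind]; ring, fun _ _ => by simp [firstKind]; ring⟩ (fun b => ?_) v
  refine eq_of_isLinearMap (f := fun u => G x (chrVec G x u (stdVec b)) (stdVec d))
    (g := fun u => firstKind G x u (stdVec b) (stdVec d))
    ⟨fun _ _ => by simp [(isLinearMap_chrVec_left G x _).map_add],
      fun _ _ => by simp [(isLinearMap_chrVec_left G x _).map_smul]⟩
    ⟨fun _ _ => by simp [firstKind]; ring, fun _ _ => by simp [firstKind]; ring⟩ (fun a => ?_) u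
  let T : Fin n → ℝ := fun d => firstKind G x (stdVec a) (stdVec b) (stdVec d)
  have h1 : ∀ c, chrVec G x (stdVec a) (stdVec b) c = ((gram G x)⁻¹.mulVec T) c := by
    intro c
    rw [chrVec_stdVec, christoffel, Matrix.mulVec, dotProduct, Finset.mul_sum]
    refine Finset.sum_congr rfl fun d _ => ?_
    simp only [partialDeriv_gram hG, T, firstKind]
    ring
  have h2 : (gram G x).mulVec ((gram G x)⁻¹.mulVec T) = T := by
    rw [Matrix.mulVec_mulVec, Matrix.mul_nonsing_inv _ (isUnit_det_gram hpos), Matrix.one_mulVec]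
  rw [hsymm, ← sum_smul_stdVec (chrVec G x (stdVec a) (stdVec b)), map_sum]
  simp only [map_smul, smul_eq_mul, h1]
  have h3 := congrFun h2 d
  simp only [Matrix.mulVec, dotProduct, gram, Matrix.of_apply, T] at h3 ⊢
  rw [← h3]
  exact Finset.sum_congr rfl fun b _ => by ring

lemma IsRiemannianMetricOn.differentiableAt {k : WithTop ℕ∞} {G : BilinField n} {U : Set (Euc n)}
    (hG : IsRiemannianMetricOn k G U) (hk : k ≠ 0) (hU : IsOpen U) {x : Euc n} (hx : x ∈ U) :
    DifferentiableAt ℝ G x :=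
  ((hG.contDiffOn.contDiffAt (hU.mem_nhds hx)).differentiableAt hk)

/-- By Cramer's rule the entries of the inverse are quotients of determinants, polynomial in the
entries of the Gram matrix. -/
lemma contDiffAt_gram_inv {j : WithTop ℕ∞} {G : BilinField n} {x : Euc n}
    (hG : ContDiffAt ℝ j G x) (hpos : ∀ v, v ≠ 0 → 0 < G x v v) (c d : Fin n) :
    ContDiffAt ℝ j (fun x' => (gram G x')⁻¹ c d) x := by
  have hent : ∀ a b, ContDiffAt ℝ j (fun x' => gram G x' a b) x := fun a b =>
    (hG.clm_apply contDiffAt_const).clm_apply contDiffAt_const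
  have hdet : ∀ M : Euc n → Matrix (Fin n) (Fin n) ℝ,
      (∀ a b, ContDiffAt ℝ j (fun x' => M x' a b) x) → ContDiffAt ℝ j (fun x' => (M x').det) x := by
    intro M hM
    simp only [Matrix.det_apply]
    refine ContDiffAt.sum fun σ _ => ContDiffAt.const_smul _ (contDiffAt_prod fun i _ => hM _ _)
  have hinv : (fun x' => (gram G x')⁻¹ c d) =
      fun x' => (gram G x').det⁻¹ * ((gram G x').updateRow d (Pi.single c 1)).det := by
    funext x'
    rw [Matrix.inv_def, Matrix.smul_apply, Matrix.adjugate_apply, Ring.inverse_eq_inv', smul_eq_mul]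
  rw [hinv]
  refine ((hdet _ hent).inv (isUnit_det_gram hpos).ne_zero).mul (hdet _ fun a b => ?_)
  by_cases h : a = d
  · subst h
    simpa using contDiffAt_const
  · simpa [Matrix.updateRow_ne h] using hent a b

lemma contDiffAt_christoffel {j : WithTop ℕ∞} {G : BilinField n} {x : Euc n}
    (hG : ContDiffAt ℝ (j + 1) G x) (hpos : ∀ v, v ≠ 0 → 0 < G x v v) (c a b : Fin n) :
    ContDiffAt ℝ j (fun x' => christoffel G x' c a b) x := by
  have hpd : ∀ a b d, ContDiffAt ℝ j (fun x' => partialDeriv b (fun z => gram G z a d) x') x := by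
    intro a b d
    have h1 : ContDiffAt ℝ (j + 1) (fun x' => gram G x' a d) x :=
      (hG.clm_apply contDiffAt_const).clm_apply contDiffAt_const
    exact (h1.fderiv_right le_rfl).clm_apply contDiffAt_const
  unfold christoffel
  refine contDiffAt_const.mul (ContDiffAt.sum fun d _ => ?_)
  exact (contDiffAt_gram_inv (hG.of_le le_self_add) hpos c d).mul
    (((hpd _ _ _).add (hpd _ _ _)).sub (hpd _ _ _))

end Christoffel

/-! ### Geodesics and the geodesic flow -/

section Geodesic

variable {n : ℕ}

lemma HasDerivAt.euc_apply {γ : ℝ → Euc n} {v : Euc n} {s : ℝ} (h : HasDerivAt γ v s)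
    (c : Fin n) : HasDerivAt (fun t => γ t c) (v c) s :=
  (hasDerivAt_pi.1 ((PiLp.continuousLinearEquiv 2 ℝ fun _ : Fin n => ℝ).hasFDerivAt.comp_hasDerivAt
    s h)) c

lemma hasDerivAt_euc_of_apply {γ : ℝ → Euc n} {v : Euc n} {s : ℝ}
    (h : ∀ c, HasDerivAt (fun t => γ t c) (v c) s) : HasDerivAt γ v s :=
  (PiLp.continuousLinearEquiv 2 ℝ fun _ : Fin n => ℝ).symm.hasFDerivAt.comp_hasDerivAt
    s (hasDerivAt_pi.2 h)

lemma hasDerivAt_fst {F F' : Type*} [NormedAddCommGroup F] [NormedSpace ℝ F]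
    [NormedAddCommGroup F'] [NormedSpace ℝ F'] {z : ℝ → F × F'} {z' : F × F'} {s : ℝ}
    (h : HasDerivAt z z' s) : HasDerivAt (fun t => (z t).1) z'.1 s :=
  (ContinuousLinearMap.fst ℝ F F').hasFDerivAt.comp_hasDerivAt s h

lemma hasDerivAt_snd {F F' : Type*} [NormedAddCommGroup F] [NormedSpace ℝ F]
    [NormedAddCommGroup F'] [NormedSpace ℝ F'] {z : ℝ → F × F'} {z' : F × F'} {s : ℝ}
    (h : HasDerivAt z z' s) : HasDerivAt (fun t => (z t).2) z'.2 s :=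
  (ContinuousLinearMap.snd ℝ F F').hasFDerivAt.comp_hasDerivAt s h

lemma IsGeodesicOn.hasDerivAt {G : BilinField n} {U : Set (Euc n)} {γ : ℝ → Euc n} {I : Set ℝ}
    (hγ : IsGeodesicOn G U γ I) {s : ℝ} (hs : s ∈ I) : HasDerivAt γ (deriv γ s) s :=
  ((hγ.contDiffOn.differentiableOn two_ne_zero).differentiableAt
    (hγ.isOpen.mem_nhds hs)).hasDerivAt

lemma IsGeodesicOn.hasDerivAt_deriv {G : BilinField n} {U : Set (Euc n)} {γ : ℝ → Euc n}
    {I : Set ℝ} (hγ : IsGeodesicOn G U γ I) {s : ℝ} (hs : s ∈ I) :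
    HasDerivAt (deriv γ) (-chrVec G (γ s) (deriv γ s) (deriv γ s)) s := by
  have hI := hγ.isOpen.mem_nhds hs
  have hd : DifferentiableAt ℝ (deriv γ) s :=
    ((hγ.contDiffOn.deriv_of_isOpen (m := 1) hγ.isOpen (by norm_num)).differentiableOn
      one_ne_zero).differentiableAt hI
  refine hasDerivAt_euc_of_apply fun c => ?_
  have h1 : ∀ c, ∀ t ∈ I, deriv (fun t => γ t c) t = deriv γ t c := fun c t ht =>
    (HasDerivAt.euc_apply (hγ.hasDerivAt ht) c).deriv
  have h2 : (fun t => deriv γ t c) =ᶠ[𝓝 s] deriv fun t => γ t c := by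
    filter_upwards [hI] with t ht using (h1 c t ht).symm
  have h3 := HasDerivAt.euc_apply hd.hasDerivAt c
  have h4 := hγ.equation s hs c
  rw [← h2.deriv_eq, h3.deriv] at h4
  rw [h4] at h3
  convert h3 using 1
  simp [chrVec_apply, h1 _ s hs]

/-- The pointwise equations give only existence of the second derivative; `hcont` makes it
continuous, as the `C²` requirement on geodesics demands. -/
lemma isGeodesicOn_of_hasDerivAt {G : BilinField n} {U : Set (Euc n)} {γ u : ℝ → Euc n}
    {I : Set ℝ} (hI : IsOpen I) (hI' : I.OrdConnected) (hU : MapsTo γ I U)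
    (hγ : ∀ s ∈ I, HasDerivAt γ (u s) s)
    (hu : ∀ s ∈ I, HasDerivAt u (-chrVec G (γ s) (u s) (u s)) s)
    (hcont : ContinuousOn (fun s => chrVec G (γ s) (u s) (u s)) I) : IsGeodesicOn G U γ I where
  isOpen := hI
  ordConnected := hI'
  mapsTo := hU
  contDiffOn := by
    have h1 : EqOn (deriv γ) u I := fun s hs => (hγ s hs).deriv
    have h2 : ContDiffOn ℝ 1 (deriv γ) I := by
      refine ContDiffOn.congr ?_ h1
      have h0 := (contDiffOn_succ_iff_deriv_of_isOpen (𝕜 := ℝ) (n := 0) (f := u) hI).2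
        ⟨fun s hs => (hu s hs).differentiableAt.differentiableWithinAt, by simp, ?_⟩
      · simpa using h0
      · rw [contDiffOn_zero]
        exact hcont.neg.congr fun s hs => (hu s hs).deriv
    have h3 := (contDiffOn_succ_iff_deriv_of_isOpen (𝕜 := ℝ) (n := 1) (f := γ) hI).2
        ⟨fun s hs => (hγ s hs).differentiableAt.differentiableWithinAt, by simp, h2⟩
    rwa [one_add_one_eq_two] at h3
  equation s hs c := by
    have h1 : ∀ c, ∀ t ∈ I, deriv (fun t => γ t c) t = u t c := fun c t ht =>
      (HasDerivAt.euc_apply (hγ t ht) c).deriv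
    have h2 : (fun t => u t c) =ᶠ[𝓝 s] deriv fun t => γ t c := by
      filter_upwards [hI.mem_nhds hs] with t ht using (h1 c t ht).symm
    rw [← h2.deriv_eq, (HasDerivAt.euc_apply (hu s hs) c).deriv]
    simp [chrVec_apply, h1 _ s hs]

/-- The Euler–Lagrange equation: the derivative of `Q(γ', W)` along a geodesic `γ`. -/
lemma hasDerivAt_metric_velocity {G : BilinField n} {γ u W : ℝ → Euc n} {s : ℝ} {W' : Euc n}
    (hG : DifferentiableAt ℝ G (γ s)) (hsymm : ∀ u v, G (γ s) u v = G (γ s) v u)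
    (hpos : ∀ v, v ≠ 0 → 0 < G (γ s) v v) (hγ : HasDerivAt γ (u s) s)
    (hu : HasDerivAt u (-chrVec G (γ s) (u s) (u s)) s) (hW : HasDerivAt W W' s) :
    HasDerivAt (fun t => G (γ t) (u t) (W t))
      ((1 / 2) * fderiv ℝ G (γ s) (W s) (u s) (u s) + G (γ s) (u s) W') s := by
  have h0 : HasDerivAt (fun t => G (γ t)) (fderiv ℝ G (γ s) (u s)) s :=
    HasFDerivAt.comp_hasDerivAt (l := G) (f := γ) s hG.hasFDerivAt hγ
  have h1 := (h0.clm_apply hu).clm_apply hW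
  refine h1.congr_deriv ?_
  -- With equal first two arguments, `firstKind` is `DG(u)(u, W) - (1/2) DG(W)(u, u)`; its first
  -- term cancels the derivative of the coefficients of `G`.
  have h2 := apply_chrVec hG hsymm hpos (u s) (u s) (W s)
  simp only [firstKind] at h2
  simp only [map_neg, add_apply, neg_apply, h2]
  ring

/-- The vector field whose integral curves are the geodesics with their velocities. -/
def geodesicField (Q : BilinField n) (z : Euc n × Euc n) : Euc n × Euc n :=
  (z.2, -chrVec Q z.1 z.2 z.2)

variable {Q : BilinField n}

lemma contDiff_geodesicField (hQ : IsRiemannianMetricOn 2 Q univ) :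
    ContDiff ℝ 1 (geodesicField Q) := by
  have hQ' : ∀ x, ContDiffAt ℝ (1 + 1) Q x := fun x => by
    rw [one_add_one_eq_two]
    exact hQ.contDiffOn.contDiffAt univ_mem
  have hΓ : ∀ c a b, ContDiff ℝ 1 fun x => christoffel Q x c a b := fun c a b =>
    contDiff_iff_contDiffAt.2 fun x =>
      contDiffAt_christoffel (hQ' x) (hQ.pos x (mem_univ x)) c a b
  have hco : ∀ a, ContDiff ℝ 1 fun z : Euc n × Euc n => z.2 a := fun a =>
    (EuclideanSpace.proj a : Euc n →L[ℝ] ℝ).contDiff.comp contDiff_snd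
  refine contDiff_snd.prodMk (ContDiff.neg ?_)
  rw [contDiff_euclidean]
  intro c
  simp only [chrVec_apply]
  exact ContDiff.sum fun a _ => ContDiff.sum fun b _ =>
    (((hΓ c a b).comp contDiff_fst).mul (hco a)).mul (hco b)

lemma isGeodesicOn_of_integralCurve (hQ : IsRiemannianMetricOn 2 Q univ)
    {z : ℝ → Euc n × Euc n} {I : Set ℝ} (hI : IsOpen I) (hI' : I.OrdConnected)
    (hz : ∀ s ∈ I, HasDerivAt z (geodesicField Q (z s)) s) :
    IsGeodesicOn Q univ (fun s => (z s).1) I := by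
  refine isGeodesicOn_of_hasDerivAt (u := fun s => (z s).2) hI hI' (mapsTo_univ _ _)
    (fun s hs => hasDerivAt_fst (hz s hs)) (fun s hs => hasDerivAt_snd (hz s hs)) ?_
  have h1 : ContinuousOn z I := fun s hs => (hz s hs).continuousAt.continuousWithinAt
  have h2 := ((contDiff_geodesicField hQ).continuous.comp_continuousOn h1).snd.neg
  exact h2.congr fun s _ => (neg_neg _).symm

lemma IsGeodesicOn.integralCurve {U : Set (Euc n)} {γ : ℝ → Euc n} {I : Set ℝ}
    (hγ : IsGeodesicOn Q U γ I) {s : ℝ} (hs : s ∈ I) :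
    HasDerivAt (fun t => (γ t, deriv γ t)) (geodesicField Q (γ s, deriv γ s)) s :=
  (hγ.hasDerivAt hs).prodMk (hγ.hasDerivAt_deriv hs)

/-- Picard–Lindelöf gives a short integral curve through each state. Its base curve is a geodesic,
which completeness extends to `ℝ`; the extension agrees with it near `0`, so it keeps the initial
velocity. -/
lemma exists_geodesicFlow (hQ : IsRiemannianMetricOn 2 Q univ) (hc : IsCompleteMetric Q) :
    ∃ φ, IsFlow (geodesicField Q) φ := by
  have h : ∀ z₀ : Euc n × Euc n, ∃ z : ℝ → Euc n × Euc n, z 0 = z₀ ∧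
      ∀ t, HasDerivAt z (geodesicField Q (z t)) t := by
    intro z₀
    obtain ⟨α, h0, ε, hε, hα⟩ := (contDiff_geodesicField hQ).contDiffAt (x := z₀)
      |>.exists_forall_mem_closedBall_exists_eq_forall_mem_Ioo_hasDerivAt₀ 0
    rw [zero_sub, zero_add] at hα
    have h0I : (0 : ℝ) ∈ Ioo (-ε) ε := ⟨by linarith, hε⟩
    obtain ⟨γ, hγ, heq⟩ := hc _ _ ⟨0, h0I⟩ (isGeodesicOn_of_integralCurve hQ isOpen_Ioo
      ordConnected_Ioo hα)
    refine ⟨fun t => (γ t, deriv γ t), ?_, fun t => hγ.integralCurve (mem_univ t)⟩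
    have h1 : γ =ᶠ[𝓝 0] fun s => (α s).1 := heq.eventuallyEq_of_mem (isOpen_Ioo.mem_nhds h0I)
    have h2 : deriv γ 0 = (α 0).2 := h1.deriv_eq.trans (hasDerivAt_fst (hα 0 h0I)).deriv
    change (γ 0, deriv γ 0) = z₀
    rw [h2, show γ 0 = (α 0).1 from h1.self_of_nhds, h0]
  choose z hz0 hz using h
  exact ⟨fun t z₀ => z z₀ t, hz0, fun z₀ t => hz z₀ t⟩

end Geodesic

/-! ### Lengths, energies and the Riemannian distance on `ℝⁿ` -/

section Distance

variable {n : ℕ} {Q : BilinField n}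

lemma pathLength_nonneg (γ : ℝ → Euc n) {a b : ℝ} (hab : a ≤ b) : 0 ≤ pathLength Q γ a b :=
  intervalIntegral.integral_nonneg hab fun _ _ => Real.sqrt_nonneg _

lemma riemDist_nonneg (U : Set (Euc n)) (x y : Euc n) : 0 ≤ riemDist Q U x y := by
  refine Real.sInf_nonneg ?_
  rintro L ⟨γ, a, b, hab, -, -, -, -, rfl⟩
  exact pathLength_nonneg γ hab

lemma riemDist_le_pathLength {γ : ℝ → Euc n} {a b : ℝ} (hab : a ≤ b) (hγ : IsPiecewiseC1 γ a b) :
    riemDist Q univ (γ a) (γ b) ≤ pathLength Q γ a b := by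
  refine csInf_le ⟨0, ?_⟩ ⟨γ, a, b, hab, hγ, mapsTo_univ _ _, rfl, rfl, rfl⟩
  rintro L ⟨γ, a, b, hab, -, -, -, -, rfl⟩
  exact pathLength_nonneg γ hab

lemma isPiecewiseC1_of_contDiff {γ : ℝ → Euc n} (hγ : ContDiff ℝ 1 γ) {a b : ℝ} (hab : a ≤ b) :
    IsPiecewiseC1 γ a b := by
  refine ⟨hγ.continuous.continuousOn, 1, fun i => if i = 0 then a else b, ?_, by simp, by simp,
    fun i _ => hγ.contDiffOn⟩
  refine monotone_nat_of_le_succ fun i => ?_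
  by_cases h : i = 0 <;> simp [h, hab]

lemma exists_path_lt (x y : Euc n) {L : ℝ} (hL : riemDist Q univ x y < L) :
    ∃ (γ : ℝ → Euc n) (a b : ℝ), a ≤ b ∧ IsPiecewiseC1 γ a b ∧ γ a = x ∧ γ b = y ∧
      pathLength Q γ a b < L := by
  have hne : {L : ℝ | ∃ (γ : ℝ → Euc n) (a b : ℝ), a ≤ b ∧ IsPiecewiseC1 γ a b ∧
      MapsTo γ (Icc a b) univ ∧ γ a = x ∧ γ b = y ∧ L = pathLength Q γ a b}.Nonempty := by
    refine ⟨_, fun t : ℝ => x + t • (y - x), 0, 1, zero_le_one,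
      isPiecewiseC1_of_contDiff (by fun_prop) zero_le_one, mapsTo_univ _ _, by simp, by simp, rfl⟩
  obtain ⟨_, ⟨γ, a, b, hab, h1, -, h2, h3, rfl⟩, h4⟩ := exists_lt_of_csInf_lt hne hL
  exact ⟨γ, a, b, hab, h1, h2, h3, h4⟩

/-- At the break points `deriv γ` may be meaningless, but inside each piece it equals the one-sided
derivative, which is continuous up to the ends. -/
lemma intervalIntegrable_speed (hQ : Continuous Q) {γ : ℝ → Euc n} {a b : ℝ}
    (hγ : IsPiecewiseC1 γ a b) :
    IntervalIntegrable (fun s => Real.sqrt (Q (γ s) (deriv γ s) (deriv γ s))) MeasureTheory.volume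
      a b := by
  obtain ⟨-, N, t, ht, rfl, rfl, hC⟩ := hγ
  refine IntervalIntegrable.trans_iterate fun i hi => ?_
  have hle : t i ≤ t (i + 1) := ht (Nat.le_succ i)
  rcases hle.eq_or_lt with heq | hlt
  · rw [heq]
  have h1 : ContinuousOn (derivWithin γ (Icc (t i) (t (i + 1)))) (Icc (t i) (t (i + 1))) :=
    (hC i hi).continuousOn_derivWithin (uniqueDiffOn_Icc hlt) le_rfl
  have h2 : ContinuousOn (fun s => Real.sqrt (Q (γ s) (derivWithin γ (Icc (t i) (t (i + 1))) s)
      (derivWithin γ (Icc (t i) (t (i + 1))) s))) (Icc (t i) (t (i + 1))) :=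
    Real.continuous_sqrt.comp_continuousOn
      (((hQ.comp_continuousOn (hC i hi).continuousOn).clm_apply h1).clm_apply h1)
  rw [← uIcc_of_le hle] at h2
  refine h2.intervalIntegrable.congr_uIoo fun s hs => ?_
  rw [uIoo_of_le hle] at hs
  simp only [uIcc_of_le hle, derivWithin_of_mem_nhds (Icc_mem_nhds hs.1 hs.2)]

lemma riemDist_triangle (hQ : Continuous Q) (x y z : Euc n) :
    riemDist Q univ x z ≤ riemDist Q univ x y + riemDist Q univ y z := by
  refine le_of_forall_pos_le_add fun ε hε => ?_
  obtain ⟨γ₁, a, b, hab, hγ₁, rfl, hy₁, hL₁⟩ :=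
    exists_path_lt (Q := Q) x y (lt_add_of_pos_right _ (half_pos hε))
  obtain ⟨γ₂, c, d, hcd, hγ₂, hy₂, rfl, hL₂⟩ :=
    exists_path_lt (Q := Q) y z (lt_add_of_pos_right _ (half_pos hε))
  let e := b + (d - c)
  have hbe : b ≤ e := by simp only [e]; linarith
  -- Concatenation of two nearly optimal paths, the second shifted in time so as to start at `b`.
  let γ : ℝ → Euc n := fun s => if s ≤ b then γ₁ s else γ₂ (s + (c - b))
  have hl : ∀ s, s ≤ b → γ s = γ₁ s := fun s hs => if_pos hs
  have hr : ∀ s, b ≤ s → γ s = γ₂ (s + (c - b)) := by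
    intro s hs
    rcases hs.eq_or_lt with rfl | hs
    · rw [hl _ le_rfl, hy₁, add_sub_cancel, hy₂]
    · exact if_neg (not_le.2 hs)
  have hmaps : MapsTo (fun s : ℝ => s + (c - b)) (Icc b e) (Icc c d) := fun s hs => by
    simp only [e, mem_Icc] at hs ⊢
    constructor <;> linarith
  have hγ : IsPiecewiseC1 γ a e := by
    obtain ⟨hc₁, N₁, t₁, ht₁, h0₁, hN₁, hC₁⟩ := hγ₁
    obtain ⟨hc₂, N₂, t₂, ht₂, h0₂, hN₂, hC₂⟩ := hγ₂
    -- At the junction `i = N₁` the two formulas for the subdivision agree, since `t₁ N₁ = b = t₂ 0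
    -- + (b - c)`.
    refine ⟨?_, N₁ + N₂, fun i => if i ≤ N₁ then t₁ i else t₂ (i - N₁) + (b - c), ?_, ?_, ?_, ?_⟩
    · rw [← Icc_union_Icc_eq_Icc hab hbe]
      refine ContinuousOn.union_of_isClosed ?_ ?_ isClosed_Icc isClosed_Icc
      · exact hc₁.congr fun s hs => hl s hs.2
      · exact (hc₂.comp (by fun_prop) hmaps).congr fun s hs => hr s hs.1
    · refine monotone_nat_of_le_succ fun i => ?_
      rcases lt_trichotomy i N₁ with h | rfl | h
      · simpa [h.le, Nat.succ_le_of_lt h] using ht₁ (Nat.le_succ i)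
      · have := ht₂ (Nat.zero_le 1)
        simp only [le_refl, if_true, Nat.not_succ_le_self, if_false, add_tsub_cancel_left]
        linarith
      · rw [if_neg (by omega), if_neg (by omega)]
        have := ht₂ (show i - N₁ ≤ i + 1 - N₁ by omega)
        linarith
    · simpa using h0₁
    · rcases Nat.eq_zero_or_pos N₂ with rfl | h
      · simp only [add_zero, le_refl, if_true, hN₁, e]
        linarith
      · dsimp only
        rw [if_neg (by omega), add_tsub_cancel_left, hN₂]
        simp only [e]
        ring
    · intro i hi
      rcases lt_or_ge i N₁ with h | h
      · simp only [h.le, if_true, Nat.succ_le_of_lt h]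
        refine (hC₁ i h).congr fun s hs => hl s (hs.2.trans ?_)
        rw [← hN₁]
        exact ht₁ h
      · have h1 : (if i ≤ N₁ then t₁ i else t₂ (i - N₁) + (b - c)) = t₂ (i - N₁) + (b - c) := by
          rcases h.eq_or_lt with rfl | h
          · simp [hN₁, h0₂]
          · exact if_neg (not_le.2 h)
        have h2 : i + 1 - N₁ = (i - N₁) + 1 := by omega
        dsimp only
        rw [h1, if_neg (by omega), h2]
        have h3 : MapsTo (fun s : ℝ => s + (c - b))
            (Icc (t₂ (i - N₁) + (b - c)) (t₂ (i - N₁ + 1) + (b - c)))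
            (Icc (t₂ (i - N₁)) (t₂ (i - N₁ + 1))) := fun s hs => by
          simp only [mem_Icc] at hs ⊢
          constructor <;> linarith
        refine ((hC₂ (i - N₁) (by omega)).comp (by fun_prop) h3).congr fun s hs => hr s ?_
        have h4 := ht₂ (Nat.zero_le (i - N₁))
        have h5 := hs.1
        linarith
  have hlen : pathLength Q γ a e = pathLength Q γ₁ a b + pathLength Q γ₂ c d := by
    have hint := intervalIntegrable_speed hQ hγ
    have h1 : IntervalIntegrable (fun s => Real.sqrt (Q (γ s) (deriv γ s) (deriv γ s)))
        MeasureTheory.volume a b :=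
      hint.mono_set (uIcc_subset_uIcc_left (by rw [uIcc_of_le (hab.trans hbe)]; exact ⟨hab, hbe⟩))
    have h2 : IntervalIntegrable (fun s => Real.sqrt (Q (γ s) (deriv γ s) (deriv γ s)))
        MeasureTheory.volume b e :=
      hint.mono_set (uIcc_subset_uIcc_right (by rw [uIcc_of_le (hab.trans hbe)]; exact ⟨hab, hbe⟩))
    unfold pathLength
    rw [← intervalIntegral.integral_add_adjacent_intervals h1 h2]
    congr 1
    · refine intervalIntegral.integral_congr_Ioo_of_le hab fun s hs => ?_
      have h3 : γ =ᶠ[𝓝 s] γ₁ := by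
        filter_upwards [Iio_mem_nhds hs.2] with t ht using hl t (le_of_lt ht)
      simp only [h3.deriv_eq, hl s hs.2.le]
    · have h4 : ∫ s in b..e, Real.sqrt (Q (γ s) (deriv γ s) (deriv γ s)) =
          ∫ s in b..e, (fun s => Real.sqrt (Q (γ₂ s) (deriv γ₂ s) (deriv γ₂ s))) (s + (c - b)) := by
        refine intervalIntegral.integral_congr_Ioo_of_le hbe fun s hs => ?_
        have h3 : γ =ᶠ[𝓝 s] fun t => γ₂ (t + (c - b)) := by
          filter_upwards [Ioi_mem_nhds hs.1] with t ht using hr t (le_of_lt ht)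
        simp only [h3.deriv_eq, hr s hs.1.le, deriv_comp_add_const]
      rw [h4, intervalIntegral.integral_comp_add_right
        (fun s => Real.sqrt (Q (γ₂ s) (deriv γ₂ s) (deriv γ₂ s)))]
      rw [add_sub_cancel, show e + (c - b) = d by simp only [e]; ring]
  have hfin := riemDist_le_pathLength (Q := Q) (hab.trans hbe) hγ
  have hge : γ e = γ₂ d := by
    rw [hr e hbe]
    congr 1
    simp only [e]
    ring
  rw [hl a hab, hge, hlen] at hfin
  linarith

/-- Cauchy–Schwarz on the unit interval: integrate `(√f - m)² ≥ 0`, where `m` is the mean of `√f`.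
-/
lemma sq_integral_sqrt_le {f : ℝ → ℝ} (hf : Continuous f) (hf0 : ∀ s, 0 ≤ f s) :
    (∫ s in (0 : ℝ)..1, Real.sqrt (f s)) ^ 2 ≤ ∫ s in (0 : ℝ)..1, f s := by
  set m := ∫ s in (0 : ℝ)..1, Real.sqrt (f s)
  have hc : Continuous fun s => Real.sqrt (f s) := hf.sqrt
  have h1 : 0 ≤ ∫ s in (0 : ℝ)..1, (f s - 2 * m * Real.sqrt (f s) + m ^ 2) := by
    refine intervalIntegral.integral_nonneg zero_le_one fun s _ => ?_
    nlinarith [sq_nonneg (Real.sqrt (f s) - m), Real.sq_sqrt (hf0 s)]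
  rw [intervalIntegral.integral_add, intervalIntegral.integral_sub,
    intervalIntegral.integral_const_mul] at h1
  · simp only [intervalIntegral.integral_const, sub_zero, one_smul] at h1
    change 0 ≤ _ - 2 * m * m + m ^ 2 at h1
    linarith
  · exact hf.intervalIntegrable _ _
  · exact (continuous_const.mul hc).intervalIntegrable _ _
  · exact (hf.sub (continuous_const.mul hc)).intervalIntegrable _ _
  · exact continuous_const.intervalIntegrable _ _

lemma IsRiemannianMetricOn.nonneg {k : WithTop ℕ∞} {U : Set (Euc n)}
    (hQ : IsRiemannianMetricOn k Q U) {x : Euc n} (hx : x ∈ U) (v : Euc n) : 0 ≤ Q x v v := by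
  by_cases hv : v = 0
  · simp [hv]
  · exact (hQ.pos x hx v hv).le

/-- Passing from length to energy avoids the square root, so that competitors can be compared by
Taylor expansion even where their velocity vanishes. -/
lemma sq_riemDist_le_energy {k : WithTop ℕ∞} (hQ : IsRiemannianMetricOn k Q univ)
    {γ γ' : ℝ → Euc n} (hγ : ∀ t, HasDerivAt γ (γ' t) t) (hγ' : Continuous γ') :
    riemDist Q univ (γ 0) (γ 1) ^ 2 ≤ ∫ s in (0 : ℝ)..1, Q (γ s) (γ' s) (γ' s) := by
  have hQc : Continuous Q := continuousOn_univ.1 hQ.contDiffOn.continuousOn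
  have hd : deriv γ = γ' := funext fun t => (hγ t).deriv
  have hγ1 : ContDiff ℝ 1 γ := by
    rw [contDiff_one_iff_deriv, hd]
    exact ⟨fun t => (hγ t).differentiableAt, hγ'⟩
  refine le_trans (pow_le_pow_left₀ (riemDist_nonneg _ _ _)
    (riemDist_le_pathLength zero_le_one (isPiecewiseC1_of_contDiff hγ1 zero_le_one)) 2) ?_
  rw [pathLength, hd]
  exact sq_integral_sqrt_le (((hQc.comp hγ1.continuous).clm_apply hγ').clm_apply hγ')
    fun s => hQ.nonneg (mem_univ _) _

end Distance

/-! ### Variation of the energy of a geodesic -/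

section Energy

variable {n : ℕ} {Q : BilinField n}

/-- The squared length of a tangent vector. -/
def energyDensity (Q : BilinField n) (z : Euc n × Euc n) : ℝ := Q z.1 z.2 z.2

lemma contDiff_energyDensity (hQ : IsRiemannianMetricOn 2 Q univ) :
    ContDiff ℝ 2 (energyDensity Q) :=
  (((contDiffOn_univ.1 hQ.contDiffOn).comp contDiff_fst).clm_apply contDiff_snd).clm_apply
    contDiff_snd

lemma fderiv_energyDensity (hQ : IsRiemannianMetricOn 2 Q univ) (z w : Euc n × Euc n) :
    fderiv ℝ (energyDensity Q) z w =
      fderiv ℝ Q z.1 w.1 z.2 z.2 + 2 * Q z.1 z.2 w.2 := by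
  have h0 : HasFDerivAt (fun z : Euc n × Euc n => Q z.1)
      ((fderiv ℝ Q z.1).comp (ContinuousLinearMap.fst ℝ (Euc n) (Euc n))) z :=
    HasFDerivAt.comp (g := Q) (f := fun z : Euc n × Euc n => z.1) z
      (hQ.differentiableAt two_ne_zero isOpen_univ (mem_univ _)).hasFDerivAt
      (hasFDerivAt_fst (𝕜 := ℝ) (E := Euc n) (F := Euc n))
  have h1 := (h0.clm_apply (hasFDerivAt_snd (𝕜 := ℝ))).clm_apply (hasFDerivAt_snd (𝕜 := ℝ))
  have h2 : fderiv ℝ (energyDensity Q) z = _ := h1.fderiv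
  rw [h2]
  have h3 := hQ.symm z.1 (mem_univ _) w.2 z.2
  simp [h3]
  ring

/-- The differential of a `C²` function is Lipschitz on a ball containing every segment from a point
of `K` with displacement at most `r`; this makes the Taylor constant uniform. -/
lemma exists_quadratic_bound {F : Type*} [NormedAddCommGroup F] [NormedSpace ℝ F]
    [FiniteDimensional ℝ F] {f : F → ℝ} (hf : ContDiff ℝ 2 f) {K : Set F} (hK : IsCompact K)
    (r : ℝ) : ∃ C, 0 ≤ C ∧ ∀ x ∈ K, ∀ v, ‖v‖ ≤ r → f (x + v) ≤ f x + fderiv ℝ f x v + C * ‖v‖ ^ 2 := by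
  obtain ⟨R, hR⟩ := hK.isBounded.subset_closedBall 0
  have hf' : ContDiff ℝ 1 (fderiv ℝ f) := hf.fderiv_right (by norm_num)
  obtain ⟨L, hL⟩ := exists_lipschitzOnWith_closedBall hf' (R + r)
  refine ⟨L, L.2, fun x hx v hv => ?_⟩
  have hxR : ‖x‖ ≤ R := by simpa using hR hx
  have hseg : ∀ y ∈ segment ℝ x (x + v), y ∈ Metric.closedBall (0 : F) (R + r) ∧ ‖y - x‖ ≤ ‖v‖ := by
    intro y hy
    rw [segment_eq_image'] at hy
    obtain ⟨θ, hθ, rfl⟩ := hy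
    have h1 : ‖θ • v‖ ≤ ‖v‖ := by
      rw [norm_smul, Real.norm_eq_abs, abs_of_nonneg hθ.1]
      exact mul_le_of_le_one_left (norm_nonneg _) hθ.2
    rw [add_sub_cancel_left, add_sub_cancel_left, mem_closedBall_zero_iff]
    exact ⟨(norm_add_le _ _).trans (add_le_add hxR (h1.trans hv)), h1⟩
  have key := (convex_segment (𝕜 := ℝ) x (x + v)).norm_image_sub_le_of_norm_fderiv_le'
    (f := f) (φ := fderiv ℝ f x) (C := L * ‖v‖)
    (fun y _ => hf.differentiable two_ne_zero y) (fun y hy => ?_)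
    (left_mem_segment ..) (right_mem_segment ..)
  · rw [add_sub_cancel_left, Real.norm_eq_abs] at key
    have := (abs_le.1 key).2
    nlinarith
  · refine (hL.norm_sub_le (hseg y hy).1 (hseg x (left_mem_segment ..)).1).trans ?_
    gcongr
    exact (hseg y hy).2

variable {φ : ℝ → Euc n × Euc n → Euc n × Euc n}

lemma IsFlow.hasDerivAt_fst (hφ : IsFlow (geodesicField Q) φ) (z : Euc n × Euc n) (t : ℝ) :
    HasDerivAt (fun s => (φ s z).1) (φ t z).2 t :=
  RiemObs.hasDerivAt_fst (hφ.hasDerivAt z t)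

lemma IsFlow.hasDerivAt_snd (hφ : IsFlow (geodesicField Q) φ) (z : Euc n × Euc n) (t : ℝ) :
    HasDerivAt (fun s => (φ s z).2) (-chrVec Q (φ t z).1 (φ t z).2 (φ t z).2) t :=
  RiemObs.hasDerivAt_snd (hφ.hasDerivAt z t)

lemma IsFlow.hasDerivAt_metric (hQ : IsRiemannianMetricOn 2 Q univ)
    (hφ : IsFlow (geodesicField Q) φ) (z : Euc n × Euc n) {W : ℝ → Euc n} {W' : Euc n} {t : ℝ}
    (hW : HasDerivAt W W' t) :
    HasDerivAt (fun s => Q (φ s z).1 (φ s z).2 (W s))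
      ((1 / 2) * fderiv ℝ Q (φ t z).1 (W t) (φ t z).2 (φ t z).2 + Q (φ t z).1 (φ t z).2 W') t :=
  hasDerivAt_metric_velocity (γ := fun s => (φ s z).1) (u := fun s => (φ s z).2)
    (hQ.differentiableAt two_ne_zero isOpen_univ (mem_univ _))
    (hQ.symm _ (mem_univ _)) (hQ.pos _ (mem_univ _)) (hφ.hasDerivAt_fst z t)
    (hφ.hasDerivAt_snd z t) hW

/-- Geodesics have constant speed: in the Euler–Lagrange formula with `W` the velocity, the two
terms cancel. -/
lemma IsFlow.energyDensity_eq (hQ : IsRiemannianMetricOn 2 Q univ)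
    (hφ : IsFlow (geodesicField Q) φ) (t : ℝ) (z : Euc n × Euc n) :
    energyDensity Q (φ t z) = energyDensity Q z := by
  have h1 : ∀ t, HasDerivAt (fun s => energyDensity Q (φ s z)) 0 t := by
    intro t
    refine (hφ.hasDerivAt_metric hQ z (hφ.hasDerivAt_snd z t)).congr_deriv ?_
    rw [map_neg, hQ.symm _ (mem_univ _), apply_chrVec
      (hQ.differentiableAt two_ne_zero isOpen_univ (mem_univ _))
      (hQ.symm _ (mem_univ _)) (hQ.pos _ (mem_univ _)), firstKind]
    ring
  have h2 := is_const_of_deriv_eq_zero (fun t => (h1 t).differentiableAt) (fun t => (h1 t).deriv) t 0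
  simpa [hφ.zero] using h2

lemma IsFlow.continuous (hQ : IsRiemannianMetricOn 2 Q univ)
    (hφ : IsFlow (geodesicField Q) φ) : Continuous fun q : ℝ × (Euc n × Euc n) => φ q.1 q.2 :=
  (hφ.contDiff (contDiff_geodesicField hQ)).continuous

/-- The only place where the minimizing property of geodesics enters: distance along a flow line is
elapsed time multiplied by the constant speed. -/
lemma IsFlow.riemDist_eq (hQ : IsRiemannianMetricOn 2 Q univ)
    (hmin : IsCompleteWithMinimizingGeodesics Q) (hφ : IsFlow (geodesicField Q) φ)
    (z : Euc n × Euc n) {s t : ℝ} (hst : s ≤ t) :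
    riemDist Q univ (φ s z).1 (φ t z).1 = (t - s) * Real.sqrt (energyDensity Q z) := by
  have h1 := hmin.minimizing _ (isGeodesicOn_of_integralCurve hQ isOpen_univ ordConnected_univ
    fun s _ => hφ.hasDerivAt z s) s (mem_univ _) t (mem_univ _) hst
  rw [← h1, pathLength]
  have h2 : ∀ r, Q (φ r z).1 (deriv (fun s => (φ s z).1) r) (deriv (fun s => (φ s z).1) r) =
      energyDensity Q z := by
    intro r
    rw [(hφ.hasDerivAt_fst z r).deriv]
    exact hφ.energyDensity_eq hQ r z
  simp only [h2, intervalIntegral.integral_const, smul_eq_mul]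

/-- An upper bound of second order for the squared distance near the end points of a geodesic,
uniform for the initial states in a compact set. -/
lemma exists_sq_riemDist_le (hQ : IsRiemannianMetricOn 2 Q univ)
    (hφ : IsFlow (geodesicField Q) φ) {K : Set (Euc n × Euc n)} (hK : IsCompact K) :
    ∃ C, 0 ≤ C ∧ ∀ z ∈ K, ∀ η ξ, ‖η‖ ≤ 1 → ‖ξ‖ ≤ 1 →
      riemDist Q univ (z.1 + η) ((φ 1 z).1 + ξ) ^ 2 ≤
        energyDensity Q z + (2 * Q (φ 1 z).1 (φ 1 z).2 ξ - 2 * Q z.1 z.2 η)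
          + C * (‖η‖ + ‖ξ‖) ^ 2 := by
  -- The radius `2` bounds the perturbation `(W t, ξ - η)`, of norm at most `‖η‖ + ‖ξ‖`.
  obtain ⟨C, hC, hbound⟩ := exists_quadratic_bound (contDiff_energyDensity hQ)
    ((isCompact_Icc (a := (0 : ℝ)) (b := 1)).prod hK |>.image (hφ.continuous hQ)) 2
  refine ⟨C, hC, fun z hz η ξ hη hξ => ?_⟩
  -- Adding this linear interpolation to the geodesic produces a competitor between the displaced
  -- end points.
  let W : ℝ → Euc n := fun t => (1 - t) • η + t • ξ
  have hW : ∀ t, HasDerivAt W (ξ - η) t := by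
    intro t
    have h1 : HasDerivAt (fun t : ℝ => 1 - t) (-1) t := by
      simpa using (hasDerivAt_id t).const_sub (1 : ℝ)
    refine ((h1.smul_const η).add ((hasDerivAt_id t).smul_const ξ)).congr_deriv ?_
    rw [neg_one_smul, one_smul]
    abel
  have hWc : Continuous W := continuous_iff_continuousAt.2 fun t => (hW t).continuousAt
  have hφc : Continuous fun t => φ t z := (hφ.continuous hQ).comp (by fun_prop : Continuous fun t : ℝ => (t, z))
  have h1 := sq_riemDist_le_energy hQ (γ := fun t => (φ t z).1 + W t)
    (γ' := fun t => (φ t z).2 + (ξ - η)) (fun t => (hφ.hasDerivAt_fst z t).add (hW t))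
    (by fun_prop)
  simp only [hφ.zero, W, sub_zero, one_smul, zero_smul, add_zero, sub_self, zero_add] at h1
  refine h1.trans ?_
  let D : ℝ → ℝ := fun t => fderiv ℝ (energyDensity Q) (φ t z) (W t, ξ - η)
  have hDc : Continuous D :=
    (((contDiff_energyDensity hQ).continuous_fderiv two_ne_zero).comp hφc).clm_apply
      (hWc.prodMk continuous_const)
  -- First variation: by Euler–Lagrange the linear term of the energy is the exact derivative of `2
  -- Q(γ', W)`, so only boundary terms remain.
  have hD : ∫ t in (0 : ℝ)..1, D t = 2 * Q (φ 1 z).1 (φ 1 z).2 ξ - 2 * Q z.1 z.2 η := by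
    have h2 : ∀ t, HasDerivAt (fun s => 2 * Q (φ s z).1 (φ s z).2 (W s)) (D t) t := by
      intro t
      refine ((hφ.hasDerivAt_metric hQ z (hW t)).const_mul 2).congr_deriv ?_
      simp only [D, fderiv_energyDensity hQ]
      ring
    rw [intervalIntegral.integral_eq_sub_of_hasDerivAt (fun t _ => h2 t)
      (hDc.intervalIntegrable _ _)]
    simp [W, hφ.zero]
  rw [← hD]
  have h3 : energyDensity Q z + (∫ t in (0 : ℝ)..1, D t) + C * (‖η‖ + ‖ξ‖) ^ 2 =
      ∫ t in (0 : ℝ)..1, (energyDensity Q z + D t + C * (‖η‖ + ‖ξ‖) ^ 2) := by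
    rw [intervalIntegral.integral_add, intervalIntegral.integral_add]
    · simp
    · exact continuous_const.intervalIntegrable _ _
    · exact hDc.intervalIntegrable _ _
    · exact (continuous_const.add hDc).intervalIntegrable _ _
    · exact continuous_const.intervalIntegrable _ _
  rw [h3]
  refine intervalIntegral.integral_mono_on zero_le_one ?_ ?_ fun t ht => ?_
  · have h4 : Continuous fun t => energyDensity Q (φ t z + (W t, ξ - η)) :=
      (contDiff_energyDensity hQ).continuous.comp (hφc.add (hWc.prodMk continuous_const))
    exact h4.intervalIntegrable _ _
  · exact ((continuous_const.add hDc).add continuous_const).intervalIntegrable _ _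
  · have h5 : ‖W t‖ ≤ ‖η‖ + ‖ξ‖ := by
      refine (norm_add_le _ _).trans (add_le_add ?_ ?_)
      · rw [norm_smul, Real.norm_eq_abs, abs_of_nonneg (by linarith [ht.2])]
        exact mul_le_of_le_one_left (norm_nonneg _) (by linarith [ht.1])
      · rw [norm_smul, Real.norm_eq_abs, abs_of_nonneg ht.1]
        exact mul_le_of_le_one_left (norm_nonneg _) ht.2
    have h6 : ‖(W t, ξ - η)‖ ≤ ‖η‖ + ‖ξ‖ := by
      rw [Prod.norm_mk]
      exact max_le h5 (by rw [add_comm]; exact norm_sub_le _ _)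
    have h7 := hbound (φ t z) ⟨(t, z), ⟨ht, hz⟩, rfl⟩ (W t, ξ - η) (by linarith)
    rw [hφ.energyDensity_eq hQ] at h7
    refine h7.trans ?_
    gcongr

end Energy

/-! ### The exponential map and the regularity of the squared distance -/

section Exponential

variable {n : ℕ} {Q : BilinField n} {φ : ℝ → Euc n × Euc n → Euc n × Euc n}

lemma IsFlow.neg_one_one (hQ : IsRiemannianMetricOn 2 Q univ)
    (hφ : IsFlow (geodesicField Q) φ) (z : Euc n × Euc n) : φ (-1) (φ 1 z) = z := by
  rw [← hφ.add (contDiff_geodesicField hQ), neg_add_cancel, hφ.zero]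

lemma IsFlow.contDiff_apply (hQ : IsRiemannianMetricOn 2 Q univ)
    (hφ : IsFlow (geodesicField Q) φ) (t : ℝ) : ContDiff ℝ 1 (φ t) :=
  (hφ.contDiff (contDiff_geodesicField hQ)).comp (contDiff_const.prodMk contDiff_id)

/-- Second-order expansion of the squared distance at the end point of a geodesic. -/
lemma exists_sq_riemDist_expansion (hQ : IsRiemannianMetricOn 2 Q univ)
    (hmin : IsCompleteWithMinimizingGeodesics Q) (hφ : IsFlow (geodesicField Q) φ)
    {K : Set (Euc n × Euc n)} (hK : IsCompact K) :
    ∃ C, 0 ≤ C ∧ ∀ z ∈ K, ∀ ξ, ‖ξ‖ ≤ 1 →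
      |riemDist Q univ z.1 ((φ 1 z).1 + ξ) ^ 2 - energyDensity Q z
        - 2 * Q (φ 1 z).1 (φ 1 z).2 ξ| ≤ C * ‖ξ‖ ^ 2 := by
  obtain ⟨C₁, hC₁, h₁⟩ := exists_sq_riemDist_le hQ hφ hK
  -- For the lower bound: the same estimate on the continuation from time `1` to time `2`, with its
  -- initial point moved by `ξ`.
  obtain ⟨C₂, hC₂, h₂⟩ := exists_sq_riemDist_le hQ hφ
    (hK.image (hφ.contDiff_apply hQ 1).continuous)
  refine ⟨max C₁ C₂, le_max_of_le_left hC₁, fun z hz ξ hξ => ?_⟩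
  have hu := h₁ z hz 0 ξ (by simp) hξ
  have hl := h₂ (φ 1 z) (mem_image_of_mem _ hz) ξ 0 hξ (by simp)
  rw [hφ.energyDensity_eq hQ] at hl
  simp only [map_zero, mul_zero, sub_zero, add_zero, zero_add, norm_zero, zero_sub] at hu hl
  have htri := riemDist_triangle (continuousOn_univ.1 hQ.contDiffOn.continuousOn) z.1
    ((φ 1 z).1 + ξ) (φ 1 (φ 1 z)).1
  have hlen := hφ.riemDist_eq hQ hmin z (zero_le_two (α := ℝ))
  rw [hφ.zero, show φ 2 z = φ 1 (φ 1 z) by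
    rw [← hφ.add (contDiff_geodesicField hQ)]; norm_num, sub_zero] at hlen
  rw [hlen] at htri
  have hE : 0 ≤ energyDensity Q z := hQ.nonneg (mem_univ _) _
  have hsq := Real.sq_sqrt hE
  have hs0 := Real.sqrt_nonneg (energyDensity Q z)
  have hmul₁ : C₁ * ‖ξ‖ ^ 2 ≤ max C₁ C₂ * ‖ξ‖ ^ 2 := by gcongr; exact le_max_left _ _
  have hmul₂ : C₂ * ‖ξ‖ ^ 2 ≤ max C₁ C₂ * ‖ξ‖ ^ 2 := by gcongr; exact le_max_right _ _
  set A := riemDist Q univ z.1 ((φ 1 z).1 + ξ)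
  set B := riemDist Q univ ((φ 1 z).1 + ξ) (φ 1 (φ 1 z)).1
  set S := Real.sqrt (energyDensity Q z)
  -- The whole geodesic up to time `2` has length `2S`. Hence `4S² ≤ (A + B)² ≤ 2A² + 2B²`, and the
  -- upper bound on `B²` becomes a lower bound on `A²` with the same linear term.
  have h3 : (2 * S) ^ 2 ≤ (A + B) ^ 2 := pow_le_pow_left₀ (by positivity) htri 2
  rw [abs_le]
  constructor
  · nlinarith [sq_nonneg (A - B)]
  · linarith

/-- Testing with `ξ = r • d` and dividing by `r` gives `Q(d, d) ≤ C r ‖d‖²`, which tends to `0` with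
`r`. -/
lemma eq_zero_of_apply_le_sq (hQ : IsRiemannianMetricOn 2 Q univ) {x d : Euc n} {C : ℝ}
    (h : ∀ ξ, ‖ξ‖ ≤ 1 → Q x d ξ ≤ C * ‖ξ‖ ^ 2) : d = 0 := by
  by_contra hd
  have hpos := hQ.pos x (mem_univ _) d hd
  have h1 : ∀ᶠ r : ℝ in 𝓝[>] 0, Q x d d ≤ C * r * ‖d‖ ^ 2 := by
    have h2 : ∀ᶠ r : ℝ in 𝓝[>] 0, ‖r • d‖ < 1 := by
      have h3 : Tendsto (fun r : ℝ => ‖r • d‖) (𝓝[>] 0) (𝓝 0) := by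
        refine Tendsto.mono_left (Continuous.tendsto' (by fun_prop) _ _ (by simp)) nhdsWithin_le_nhds
      exact h3.eventually_lt_const one_pos
    filter_upwards [h2, self_mem_nhdsWithin] with r hr (hr0 : 0 < r)
    have h3 := h (r • d) hr.le
    rw [map_smul, smul_eq_mul, norm_smul, Real.norm_eq_abs, abs_of_pos hr0] at h3
    refine le_of_mul_le_mul_left (h3.trans_eq ?_) hr0
    ring
  have h4 : Tendsto (fun r : ℝ => C * r * ‖d‖ ^ 2) (𝓝[>] 0) (𝓝 0) :=
    Tendsto.mono_left (Continuous.tendsto' (by fun_prop) _ _ (by simp)) nhdsWithin_le_nhds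
  exact absurd (ge_of_tendsto h4 h1) (not_le.2 hpos)

/-- The map `(y, v) ↦ (y, exp_y v)`. -/
def expPair (φ : ℝ → Euc n × Euc n → Euc n × Euc n) (z : Euc n × Euc n) : Euc n × Euc n :=
  (z.1, (φ 1 z).1)

lemma contDiff_expPair (hQ : IsRiemannianMetricOn 2 Q univ)
    (hφ : IsFlow (geodesicField Q) φ) : ContDiff ℝ 1 (expPair φ) :=
  contDiff_fst.prodMk (contDiff_fst.comp (hφ.contDiff_apply hQ 1))

lemma sq_riemDist_expPair (hQ : IsRiemannianMetricOn 2 Q univ)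
    (hmin : IsCompleteWithMinimizingGeodesics Q) (hφ : IsFlow (geodesicField Q) φ)
    (z : Euc n × Euc n) :
    riemDist Q univ (expPair φ z).1 (expPair φ z).2 ^ 2 = energyDensity Q z := by
  have h := hφ.riemDist_eq hQ hmin z (zero_le_one (α := ℝ))
  rw [hφ.zero, sub_zero, one_mul] at h
  rw [expPair, h, Real.sq_sqrt]
  exact hQ.nonneg (mem_univ _) _

/-- Two geodesics with the same ends give two expansions of one squared distance function, with
linear terms given by their final velocities. These velocities therefore agree, and flowing back by
time `1` recovers the initial states. -/
lemma expPair_injective (hQ : IsRiemannianMetricOn 2 Q univ)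
    (hmin : IsCompleteWithMinimizingGeodesics Q) (hφ : IsFlow (geodesicField Q) φ) :
    Function.Injective (expPair φ) := by
  intro z₁ z₂ h
  obtain ⟨C, hC, hexp⟩ := exists_sq_riemDist_expansion hQ hmin hφ
    ((finite_singleton z₂).insert z₁).isCompact
  have h1 : z₁.1 = z₂.1 := (Prod.ext_iff.1 h).1
  have h2 : (φ 1 z₁).1 = (φ 1 z₂).1 := (Prod.ext_iff.1 h).2
  have hE : energyDensity Q z₁ = energyDensity Q z₂ := by
    rw [← sq_riemDist_expPair hQ hmin hφ z₁, h, sq_riemDist_expPair hQ hmin hφ z₂]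
  have h3 : (φ 1 z₁).2 - (φ 1 z₂).2 = 0 := by
    refine eq_zero_of_apply_le_sq hQ (x := (φ 1 z₂).1) (C := C) fun ξ hξ => ?_
    have e₁ := hexp z₁ (mem_insert _ _) ξ hξ
    have e₂ := hexp z₂ (mem_insert_of_mem _ rfl) ξ hξ
    rw [h1, h2, hE] at e₁
    rw [map_sub, sub_apply]
    linarith [(abs_le.1 e₁).1, (abs_le.1 e₂).2]
  have h4 : φ 1 z₁ = φ 1 z₂ := Prod.ext h2 (sub_eq_zero.1 h3)
  rw [← hφ.neg_one_one hQ z₁, h4, hφ.neg_one_one hQ]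

lemma fderiv_flow_injective (hQ : IsRiemannianMetricOn 2 Q univ)
    (hφ : IsFlow (geodesicField Q) φ) (z : Euc n × Euc n) :
    Function.Injective (fderiv ℝ (φ 1) z) := by
  have h1 := ((hφ.contDiff_apply hQ 1).differentiable one_ne_zero z).hasFDerivAt
  have h2 := ((hφ.contDiff_apply hQ (-1)).differentiable one_ne_zero (φ 1 z)).hasFDerivAt
  have h3 := h2.comp z h1
  have h4 : φ (-1) ∘ φ 1 = id := funext fun z => hφ.neg_one_one hQ z
  rw [h4] at h3
  have h5 := h3.unique (hasFDerivAt_id z)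
  exact Function.LeftInverse.injective (g := fderiv ℝ (φ (-1)) (φ 1 z)) fun w =>
    DFunLike.congr_fun h5 w

/-- There are no conjugate points. A kernel vector is a variation `w` of the initial velocity moving
the end point by `o(s)`. Comparing the expansions of the squared distance along the varied and the
original geodesic at a common point shows that the final velocity is also stationary; the flow being
a diffeomorphism, `w = 0`. -/
lemma fderiv_expPair_injective (hQ : IsRiemannianMetricOn 2 Q univ)
    (hmin : IsCompleteWithMinimizingGeodesics Q) (hφ : IsFlow (geodesicField Q) φ)
    (z : Euc n × Euc n) : Function.Injective (fderiv ℝ (expPair φ) z) := by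
  rw [injective_iff_map_eq_zero]
  rintro ⟨a, w⟩ haw
  have hφ1 := ((hφ.contDiff_apply hQ 1).differentiable one_ne_zero z).hasFDerivAt
  set L := fderiv ℝ (φ 1) z
  have hF : HasFDerivAt (expPair φ) ((ContinuousLinearMap.fst ℝ (Euc n) (Euc n)).prod
      ((ContinuousLinearMap.fst ℝ (Euc n) (Euc n)).comp L)) z :=
    (_root_.hasFDerivAt_fst).prodMk (HasFDerivAt.fst hφ1)
  rw [hF.fderiv] at haw
  have ha : a = 0 := congrArg Prod.fst haw
  subst ha
  have hL1 : (L (0, w)).1 = 0 := congrArg Prod.snd haw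
  suffices hL2 : (L (0, w)).2 = 0 by
    have : L (0, w) = L 0 := by rw [map_zero]; exact Prod.ext hL1 hL2
    exact fderiv_flow_injective hQ hφ z this
  let c : ℝ → Euc n × Euc n := fun s => z + s • ((0 : Euc n), w)
  have hc1 : ∀ s, (c s).1 = z.1 := fun s => by simp [c]
  have hc0 : c 0 = z := by simp [c]
  have hcc : Continuous c := by fun_prop
  obtain ⟨C, hC, hexp⟩ := exists_sq_riemDist_expansion hQ hmin hφ
    ((isCompact_Icc (a := (0 : ℝ)) (b := 1)).image hcc)
  have hcd : HasDerivAt (fun s => φ 1 (c s)) (L (0, w)) 0 := by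
    have h1 : HasDerivAt c ((0 : Euc n), w) 0 :=
      (((hasDerivAt_id (0 : ℝ)).smul_const ((0 : Euc n), w)).const_add z).congr_deriv (one_smul _ _)
    exact HasFDerivAt.comp_hasDerivAt_of_eq (0 : ℝ) hφ1 h1 hc0.symm
  have hx : HasDerivAt (fun s => (φ 1 (c s)).1) (0 : Euc n) 0 := hL1 ▸ hasDerivAt_fst hcd
  have hu : HasDerivAt (fun s => (φ 1 (c s)).2) (L (0, w)).2 0 := hasDerivAt_snd hcd
  refine eq_zero_of_apply_le_sq hQ (x := (φ 1 z).1) (C := (3 / 2) * C) fun ζ _ => ?_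
  let g : ℝ → ℝ := fun s => 2 * Q (φ 1 (c s)).1 (φ 1 (c s)).2 ζ
  have hg : HasDerivAt g (2 * Q (φ 1 z).1 (L (0, w)).2 ζ) 0 := by
    have h0 : HasDerivAt (fun s => Q (φ 1 (c s)).1) (fderiv ℝ Q (φ 1 (c 0)).1 0) 0 :=
      HasFDerivAt.comp_hasDerivAt (l := Q) (f := fun s => (φ 1 (c s)).1) (0 : ℝ)
        (hQ.differentiableAt two_ne_zero isOpen_univ (mem_univ _)).hasFDerivAt hx
    refine (((h0.clm_apply hu).clm_apply (hasDerivAt_const (0 : ℝ) ζ)).const_mul 2).congr_deriv ?_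
    simp [hc0]
  -- Three expansions are compared: the original one at `δ` and at `δ + s • ζ`, and the varied one
  -- at `s • ζ`. Their errors total at most `3C(‖δ‖² + ‖s • ζ‖²)`. After division by `s²`, the `δ`
  -- term disappears in the limit.
  have hineq : ∀ᶠ s : ℝ in 𝓝[>] 0,
      s⁻¹ • (g (0 + s) - g 0) ≤ 3 * C * (‖s⁻¹ • ((φ 1 (c (0 + s))).1 - (φ 1 (c 0)).1)‖ ^ 2
        + ‖ζ‖ ^ 2) := by
    have hsm : ∀ᶠ s : ℝ in 𝓝[>] 0, ‖(φ 1 (c s)).1 - (φ 1 z).1‖ + ‖s • ζ‖ < 1 := by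
      have hcont : Continuous fun s : ℝ => ‖(φ 1 (c s)).1 - (φ 1 z).1‖ + ‖s • ζ‖ := by
        have := (hφ.contDiff_apply hQ 1).continuous
        fun_prop
      have h3 := (hcont.tendsto' 0 0 (by simp [hc0])).mono_left (nhdsWithin_le_nhds (s := Ioi 0))
      exact h3.eventually_lt_const one_pos
    filter_upwards [hsm, Ioo_mem_nhdsGT (zero_lt_one (α := ℝ))] with s hs hs01
    have hs0 : 0 < s := hs01.1
    rw [zero_add, hc0]
    set δ := (φ 1 (c s)).1 - (φ 1 z).1
    have hδ : (φ 1 (c s)).1 = (φ 1 z).1 + δ := by simp only [δ]; abel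
    have hzK : z ∈ c '' Icc 0 1 := ⟨0, by simp, hc0⟩
    have hsK : c s ∈ c '' Icc 0 1 := ⟨s, ⟨hs0.le, hs01.2.le⟩, rfl⟩
    have hEs : riemDist Q univ z.1 ((φ 1 z).1 + δ) ^ 2 = energyDensity Q (c s) := by
      rw [← sq_riemDist_expPair hQ hmin hφ (c s), expPair, hc1, hδ]
    have n0 := norm_nonneg (s • ζ)
    have n1 := norm_nonneg δ
    have e1 := hexp z hzK δ (by linarith)
    have e2 := hexp (c s) hsK (s • ζ) (by linarith)
    have e3 := hexp z hzK (δ + s • ζ) ((norm_add_le _ _).trans (by linarith))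
    rw [hEs] at e1
    rw [hc1, show (φ 1 (c s)).1 + s • ζ = (φ 1 z).1 + (δ + s • ζ) by rw [hδ]; abel] at e2
    have hp : 2 * Q (φ 1 (c s)).1 (φ 1 (c s)).2 (s • ζ) = s * g s := by
      simp only [g, map_smul, smul_eq_mul]; ring
    have hp0 : 2 * Q (φ 1 z).1 (φ 1 z).2 (δ + s • ζ) =
        2 * Q (φ 1 z).1 (φ 1 z).2 δ + s * g 0 := by
      simp only [g, map_smul, map_add, smul_eq_mul, hc0]; ring
    rw [hp] at e2
    rw [hp0] at e3
    have hn : ‖δ + s • ζ‖ ^ 2 ≤ 2 * ‖δ‖ ^ 2 + 2 * ‖s • ζ‖ ^ 2 := by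
      have := norm_add_le δ (s • ζ)
      nlinarith [norm_nonneg (δ + s • ζ), sq_nonneg (‖δ‖ - ‖s • ζ‖)]
    have hmain : s * (g s - g 0) ≤ 3 * C * (‖δ‖ ^ 2 + ‖s • ζ‖ ^ 2) := by
      have := mul_le_mul_of_nonneg_left hn hC
      linarith [(abs_le.1 e1).1, (abs_le.1 e2).1, (abs_le.1 e3).2]
    rw [norm_smul, Real.norm_eq_abs, abs_of_pos hs0] at hmain
    rw [norm_smul, Real.norm_eq_abs, abs_of_pos (inv_pos.2 hs0), smul_eq_mul]
    refine le_of_mul_le_mul_left ?_ (pow_pos hs0 2)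
    calc s ^ 2 * (s⁻¹ * (g s - g 0)) = s * (g s - g 0) := by field_simp
      _ ≤ _ := hmain
      _ = _ := by field_simp
  have hsub : Ioi (0 : ℝ) ⊆ {0}ᶜ := fun s hs => (mem_Ioi.1 hs).ne'
  have hlim1 := (hasDerivAt_iff_tendsto_slope_zero.1 hg).mono_left
    (nhdsWithin_mono (0 : ℝ) hsub)
  have hlim2 := (hasDerivAt_iff_tendsto_slope_zero.1 hx).mono_left
    (nhdsWithin_mono (0 : ℝ) hsub)
  have hlim3 := ((hlim2.norm.pow 2).add_const (‖ζ‖ ^ 2)).const_mul (3 * C)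
  have hfin := le_of_tendsto_of_tendsto hlim1 hlim3 hineq
  simp only [norm_zero] at hfin
  linarith

end Exponential

/-! ### Diffeomorphism property of the exponential map; regularity, Hessian and monotonicity of the
squared distance -/

section SquaredDistance

variable {n : ℕ} {Q : BilinField n} {φ : ℝ → Euc n × Euc n → Euc n × Euc n}

lemma exists_hasFDerivAt_expPair (hQ : IsRiemannianMetricOn 2 Q univ)
    (hmin : IsCompleteWithMinimizingGeodesics Q) (hφ : IsFlow (geodesicField Q) φ)
    (z : Euc n × Euc n) : ∃ L : (Euc n × Euc n) ≃L[ℝ] Euc n × Euc n,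
      HasFDerivAt (expPair φ) (L : (Euc n × Euc n) →L[ℝ] Euc n × Euc n) z := by
  let L := (LinearEquiv.ofInjectiveEndo (fderiv ℝ (expPair φ) z : (Euc n × Euc n) →ₗ[ℝ] _)
    (fderiv_expPair_injective hQ hmin hφ z)).toContinuousLinearEquiv
  refine ⟨L, ?_⟩
  have h : (L : (Euc n × Euc n) →L[ℝ] Euc n × Euc n) = fderiv ℝ (expPair φ) z := by
    ext w <;> rfl
  rw [h]
  exact ((contDiff_expPair hQ hφ).differentiable one_ne_zero z).hasFDerivAt

lemma isOpenMap_expPair (hQ : IsRiemannianMetricOn 2 Q univ)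
    (hmin : IsCompleteWithMinimizingGeodesics Q) (hφ : IsFlow (geodesicField Q) φ) :
    IsOpenMap (expPair φ) := by
  rw [isOpenMap_iff_nhds_le]
  intro z
  obtain ⟨L, hL⟩ := exists_hasFDerivAt_expPair hQ hmin hφ z
  exact (((contDiff_expPair hQ hφ).contDiffAt.hasStrictFDerivAt' hL one_ne_zero).map_nhds_eq_of_equiv).ge

lemma flow_zero_velocity (hQ : IsRiemannianMetricOn 2 Q univ)
    (hφ : IsFlow (geodesicField Q) φ) (t : ℝ) (x : Euc n) : φ t (x, 0) = (x, 0) := by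
  have h : (fun t => φ t (x, 0)) = fun _ => (x, 0) := by
    refine integralCurve_unique (contDiff_geodesicField hQ) (hφ.hasDerivAt (x, 0)) (fun t => ?_)
      (hφ.zero _)
    have : geodesicField Q (x, 0) = 0 := by
      simp [geodesicField, (isLinearMap_chrVec_left Q x 0).map_zero]
    rw [this]
    exact hasDerivAt_const _ _
  exact congrFun h t

lemma exists_norm_le_of_energyDensity_le (hQ : IsRiemannianMetricOn 2 Q univ) (y : Euc n) (M : ℝ) :
    ∃ R, ∀ v, energyDensity Q (y, v) ≤ M → ‖v‖ ≤ R := by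
  have hc : Continuous fun v => energyDensity Q (y, v) :=
    (contDiff_energyDensity hQ).continuous.comp (by fun_prop)
  obtain ⟨c, hc0, hcs⟩ := (isCompact_sphere (0 : Euc n) 1).exists_forall_le' hc.continuousOn
    (fun v hv => hQ.pos y (mem_univ _) v (ne_zero_of_mem_unit_sphere ⟨v, hv⟩))
  refine ⟨Real.sqrt (M / c), fun v hv => ?_⟩
  refine Real.le_sqrt_of_sq_le ?_
  rw [le_div_iff₀ hc0]
  by_cases h0 : v = 0
  · subst h0
    simpa [energyDensity] using hv
  have hn : 0 < ‖v‖ := norm_pos_iff.2 h0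
  have h1 := hcs (‖v‖⁻¹ • v) (by simp [norm_smul, hn.ne'])
  have h2 : energyDensity Q (y, ‖v‖⁻¹ • v) = (‖v‖ ^ 2)⁻¹ * energyDensity Q (y, v) := by
    simp only [energyDensity, map_smul, smul_apply, smul_eq_mul]
    field_simp
  rw [h2, le_inv_mul_iff₀ (by positivity)] at h1
  exact h1.trans hv

/-- A Hopf–Rinow argument: for fixed `y` the set of end points is open, as `expPair` is an open map.
It is closed because end points near a given `x` have bounded distance from `y`, so their initial
velocities lie in a compact ball. -/
lemma expPair_surjective (hQ : IsRiemannianMetricOn 2 Q univ)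
    (hmin : IsCompleteWithMinimizingGeodesics Q) (hφ : IsFlow (geodesicField Q) φ) :
    Function.Surjective (expPair φ) := by
  rintro ⟨y, x₁⟩
  let S : Set (Euc n) := range fun v => (φ 1 (y, v)).1
  have hS : ∀ x, x ∈ S ↔ (y, x) ∈ range (expPair φ) := by
    refine fun x => ⟨?_, ?_⟩
    · rintro ⟨v, rfl⟩
      exact ⟨(y, v), rfl⟩
    · rintro ⟨⟨y', v⟩, hv⟩
      obtain rfl : y' = y := (Prod.ext_iff.1 hv).1
      exact ⟨v, (Prod.ext_iff.1 hv).2⟩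
  have hcont : Continuous fun v => (φ 1 (y, v)).1 := by
    have := (hφ.contDiff_apply hQ 1).continuous
    fun_prop
  have hopen : IsOpen S := by
    have h1 : S = (fun x => (y, x)) ⁻¹' range (expPair φ) := Set.ext hS
    rw [h1]
    exact (isOpenMap_expPair hQ hmin hφ).isOpen_range.preimage (by fun_prop)
  have hclosed : IsClosed S := by
    rw [← closure_subset_iff_isClosed]
    intro x hx
    -- Applied to the constant geodesic at `x`, the bound reads `dist(x, x')² ≤ C ‖x' - x‖²`.
    obtain ⟨C, hC, hbound⟩ := exists_sq_riemDist_le hQ hφ (isCompact_singleton (x := (x, (0 : Euc n))))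
    let M := (riemDist Q univ y x + Real.sqrt C) ^ 2
    obtain ⟨R, hR⟩ := exists_norm_le_of_energyDensity_le hQ y M
    have hsub : Metric.ball x 1 ∩ S ⊆ (fun v => (φ 1 (y, v)).1) '' Metric.closedBall 0 R := by
      rintro _ ⟨hb, v, rfl⟩
      refine ⟨v, ?_, rfl⟩
      rw [mem_closedBall_zero_iff]
      apply hR
      rw [← sq_riemDist_expPair hQ hmin hφ (y, v)]
      simp only [expPair] at hb ⊢
      set x' := (φ 1 (y, v)).1
      have hn : ‖x' - x‖ ≤ 1 := by
        rw [← dist_eq_norm]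
        exact (Metric.mem_ball.1 hb).le
      have h1 := hbound (x, 0) rfl 0 (x' - x) (by simp) hn
      simp only [flow_zero_velocity hQ hφ, energyDensity, map_zero, zero_apply, mul_zero, sub_self,
        add_zero, zero_add, norm_zero, add_sub_cancel] at h1
      have h2 : riemDist Q univ x x' ≤ Real.sqrt C := by
        refine Real.le_sqrt_of_sq_le (h1.trans ?_)
        exact mul_le_of_le_one_right hC (pow_le_one₀ (norm_nonneg _) hn)
      have h3 := riemDist_triangle (continuousOn_univ.1 hQ.contDiffOn.continuousOn) y x x'
      exact pow_le_pow_left₀ (riemDist_nonneg _ _ _) (by linarith) 2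
    have h1 := Metric.isOpen_ball.inter_closure ⟨Metric.mem_ball_self one_pos, hx⟩
    have h2 := closure_minimal hsub ((isCompact_closedBall (0 : Euc n) R).image hcont).isClosed h1
    obtain ⟨v, -, hv⟩ := h2
    exact ⟨v, hv⟩
  have huniv := IsClopen.eq_univ ⟨hclosed, hopen⟩ ⟨_, mem_range_self (0 : Euc n)⟩
  exact (hS x₁).1 (huniv ▸ mem_univ x₁)

/-- The differential of the squared distance at `(y, exp_y v)`, as a function of `(y, v)`. -/
def sqDistDeriv (Q : BilinField n) (φ : ℝ → Euc n × Euc n → Euc n × Euc n) (z : Euc n × Euc n) :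
    Euc n × Euc n →L[ℝ] ℝ :=
  (2 : ℝ) • (Q (φ 1 z).1 (φ 1 z).2).comp (ContinuousLinearMap.snd ℝ (Euc n) (Euc n))
    - (2 : ℝ) • (Q z.1 z.2).comp (ContinuousLinearMap.fst ℝ (Euc n) (Euc n))

lemma contDiff_sqDistDeriv (hQ : IsRiemannianMetricOn 2 Q univ)
    (hφ : IsFlow (geodesicField Q) φ) : ContDiff ℝ 1 (sqDistDeriv Q φ) := by
  have h1 : ContDiff ℝ 1 fun z : Euc n × Euc n => Q z.1 z.2 :=
    (((contDiffOn_univ.1 hQ.contDiffOn).of_le one_le_two).comp contDiff_fst).clm_apply contDiff_snd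
  exact (((h1.comp (hφ.contDiff_apply hQ 1)).clm_comp contDiff_const).const_smul _).sub
    ((h1.clm_comp contDiff_const).const_smul _)

/-- Differentiability comes from composing the energy with the `C¹` inverse `lg`. The differential
is then identified by the variational upper bound, which touches the squared distance at the given
end points; this formula, unlike the composition, shows a `C¹` differential. -/
theorem exists_hasFDerivAt_sq_riemDist (hQ : IsRiemannianMetricOn 2 Q univ)
    (hmin : IsCompleteWithMinimizingGeodesics Q) (hφ : IsFlow (geodesicField Q) φ) :
    ∃ lg : Euc n × Euc n → Euc n × Euc n, ContDiff ℝ 1 lg ∧ (∀ z, lg (expPair φ z) = z) ∧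
      ∀ a, HasFDerivAt (fun a : Euc n × Euc n => riemDist Q univ a.1 a.2 ^ 2)
        (sqDistDeriv Q φ (lg a)) a := by
  let Θ : Euc n × Euc n ≃ₜ Euc n × Euc n :=
    (Equiv.ofBijective (expPair φ) ⟨expPair_injective hQ hmin hφ,
      expPair_surjective hQ hmin hφ⟩).toHomeomorphOfContinuousOpen
      (contDiff_expPair hQ hφ).continuous (isOpenMap_expPair hQ hmin hφ)
  choose L hL using exists_hasFDerivAt_expPair hQ hmin hφ
  have hlg : ContDiff ℝ 1 Θ.symm := Θ.contDiff_symm hL (contDiff_expPair hQ hφ)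
  refine ⟨Θ.symm, hlg, Θ.symm_apply_apply, fun a => ?_⟩
  let f : Euc n × Euc n → ℝ := fun a => riemDist Q univ a.1 a.2 ^ 2
  have hf : f = energyDensity Q ∘ Θ.symm := by
    funext a
    obtain ⟨z, rfl⟩ := Θ.surjective a
    rw [Function.comp_apply, Θ.symm_apply_apply]
    exact sq_riemDist_expPair hQ hmin hφ z
  have hfd : DifferentiableAt ℝ f a := by
    rw [hf]
    exact (((contDiff_energyDensity hQ).of_le one_le_two).comp hlg).differentiable one_ne_zero a
  obtain ⟨z, rfl⟩ := Θ.surjective a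
  rw [Θ.symm_apply_apply]
  have hfz : f (Θ z) = energyDensity Q z := sq_riemDist_expPair hQ hmin hφ z
  obtain ⟨C, hC, hbound⟩ := exists_sq_riemDist_le hQ hφ (isCompact_singleton (x := z))
  suffices h : fderiv ℝ f (Θ z) = sqDistDeriv Q φ z by
    rw [← h]
    exact hfd.hasFDerivAt
  refine ContinuousLinearMap.ext fun d => ?_
  let ℓ := sqDistDeriv Q φ z d
  -- The squared distance along the direction `d` minus the upper bound, up to a constant; it has a
  -- local maximum at `0`, so its derivative there vanishes.
  let g : ℝ → ℝ := fun t => f (Θ z + t • d) - t * ℓ - C * (|t| * (‖d.1‖ + ‖d.2‖)) ^ 2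
  have hg : HasDerivAt g (fderiv ℝ f (Θ z) d - ℓ) 0 := by
    have h1 : HasDerivAt (fun t : ℝ => Θ z + t • d) d 0 :=
      (((hasDerivAt_id (0 : ℝ)).smul_const d).const_add _).congr_deriv (one_smul _ _)
    have h2 : HasDerivAt (fun t : ℝ => f (Θ z + t • d)) (fderiv ℝ f (Θ z) d) 0 :=
      HasFDerivAt.comp_hasDerivAt_of_eq (0 : ℝ) hfd.hasFDerivAt h1 (by simp)
    have h3 : HasDerivAt (fun t : ℝ => C * (|t| * (‖d.1‖ + ‖d.2‖)) ^ 2) 0 0 := by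
      have h4 := ((hasDerivAt_pow 2 (0 : ℝ)).mul_const ((‖d.1‖ + ‖d.2‖) ^ 2)).const_mul C
      simp only [mul_pow, sq_abs]
      exact h4.congr_deriv (by simp)
    exact ((h2.sub ((hasDerivAt_id (0 : ℝ)).mul_const ℓ)).sub h3).congr_deriv (by simp)
  have hmax : IsLocalMax g 0 := by
    have hsm : ∀ᶠ t : ℝ in 𝓝 0, |t| * (‖d.1‖ + ‖d.2‖) < 1 := by
      have h3 : Tendsto (fun t : ℝ => |t| * (‖d.1‖ + ‖d.2‖)) (𝓝 0) (𝓝 0) :=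
        Continuous.tendsto' (by fun_prop) _ _ (by simp)
      exact h3.eventually_lt_const one_pos
    filter_upwards [hsm] with t ht
    have hn1 : ‖t • d.1‖ = |t| * ‖d.1‖ := norm_smul _ _
    have hn2 : ‖t • d.2‖ = |t| * ‖d.2‖ := norm_smul _ _
    have p1 : 0 ≤ |t| * ‖d.1‖ := by positivity
    have p2 : 0 ≤ |t| * ‖d.2‖ := by positivity
    rw [mul_add] at ht
    have hb := hbound z rfl (t • d.1) (t • d.2) (by linarith) (by linarith)
    rw [hn1, hn2, ← mul_add] at hb
    have hb' : f (Θ z + t • d) = riemDist Q univ (z.1 + t • d.1) ((φ 1 z).1 + t • d.2) ^ 2 := rfl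
    have hℓ : t * ℓ = 2 * Q (φ 1 z).1 (φ 1 z).2 (t • d.2) - 2 * Q z.1 z.2 (t • d.1) := by
      simp only [ℓ, sqDistDeriv, sub_apply, smul_apply, ContinuousLinearMap.comp_apply,
        ContinuousLinearMap.coe_fst', ContinuousLinearMap.coe_snd', map_smul, smul_eq_mul]
      ring
    have hg0 : g 0 = energyDensity Q z := by simp [g, hfz]
    rw [hg0]
    simp only [g, hb', hℓ]
    linarith
  exact sub_eq_zero.1 (hmax.hasDerivAt_eq_zero hg)

/-- The squared distance of a complete metric with minimizing geodesics is of class `C²`. -/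
theorem contDiff_sq_riemDist (hQ : IsRiemannianMetricOn 2 Q univ)
    (hmin : IsCompleteWithMinimizingGeodesics Q) :
    ContDiff ℝ 2 fun a : Euc n × Euc n => riemDist Q univ a.1 a.2 ^ 2 := by
  obtain ⟨φ, hφ⟩ := exists_geodesicFlow hQ hmin.complete
  obtain ⟨lg, hlg, -, hd⟩ := exists_hasFDerivAt_sq_riemDist hQ hmin hφ
  have h := (contDiff_succ_iff_hasFDerivAt (𝕜 := ℝ) (n := 1)
    (f := fun a : Euc n × Euc n => riemDist Q univ a.1 a.2 ^ 2)).2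
    ⟨fun a => sqDistDeriv Q φ (lg a), (contDiff_sqDistDeriv hQ hφ).comp hlg, hd⟩
  exact h.of_le (by norm_num)

lemma IsFlow.reverse (hQ : IsRiemannianMetricOn 2 Q univ) (hφ : IsFlow (geodesicField Q) φ)
    (t : ℝ) (y v : Euc n) : (φ t (y, -v)).1 = (φ (-t) (y, v)).1 := by
  have h : (fun t => φ t (y, -v)) = fun t => ((φ (-t) (y, v)).1, -(φ (-t) (y, v)).2) := by
    refine integralCurve_unique (contDiff_geodesicField hQ) (hφ.hasDerivAt _) (fun t => ?_)
      (by simp [hφ.zero])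
    have h1 := (hφ.hasDerivAt_fst (y, v) (-t)).scomp t (hasDerivAt_neg t)
    have h2 := ((hφ.hasDerivAt_snd (y, v) (-t)).scomp t (hasDerivAt_neg t)).neg
    refine (h1.prodMk h2).congr_deriv ?_
    simp only [geodesicField, neg_smul, one_smul, neg_neg, Prod.mk.injEq, true_and]
    rw [← neg_one_smul ℝ (φ (-t) (y, v)).2, (isLinearMap_chrVec_left Q _ _).map_smul,
      (isLinearMap_chrVec_right Q _ _).map_smul]
    simp
  exact (Prod.ext_iff.1 (congrFun h t)).1

/-- The base point is the second argument of the distance, so the geodesic is traversed backwards,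
as the flow line of `(y, -v)`. -/
lemma riemDist_flow_zero (hQ : IsRiemannianMetricOn 2 Q univ)
    (hmin : IsCompleteWithMinimizingGeodesics Q) (hφ : IsFlow (geodesicField Q) φ)
    (y v : Euc n) {t : ℝ} (ht : 0 ≤ t) :
    riemDist Q univ (φ t (y, v)).1 y ^ 2 = t ^ 2 * Q y v v := by
  have h1 := hφ.riemDist_eq hQ hmin (y, -v) (neg_nonpos.2 ht)
  rw [hφ.reverse hQ, neg_neg, hφ.zero] at h1
  have h2 : energyDensity Q (y, -v) = Q y v v := by simp [energyDensity]
  rw [h1, h2, mul_pow, Real.sq_sqrt (hQ.nonneg (mem_univ _) _)]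
  ring

lemma riemDist_self (hQ : IsRiemannianMetricOn 2 Q univ)
    (hmin : IsCompleteWithMinimizingGeodesics Q) (y : Euc n) : riemDist Q univ y y = 0 := by
  obtain ⟨φ, hφ⟩ := exists_geodesicFlow hQ hmin.complete
  have h := hφ.riemDist_eq hQ hmin (y, 0) (le_refl 0)
  simpa [hφ.zero] using h

/-- The Hessian of the squared distance to a point. -/
theorem fderiv_fderiv_sq_riemDist (hQ : IsRiemannianMetricOn 2 Q univ)
    (hmin : IsCompleteWithMinimizingGeodesics Q) (y v : Euc n) :
    fderiv ℝ (fderiv ℝ fun x => riemDist Q univ x y ^ 2) y v v = 2 * Q y v v := by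
  obtain ⟨φ, hφ⟩ := exists_geodesicFlow hQ hmin.complete
  set f : Euc n → ℝ := fun x => riemDist Q univ x y ^ 2
  have hf : ContDiff ℝ 2 f := (contDiff_sq_riemDist hQ hmin).comp (contDiff_id.prodMk contDiff_const)
  let c : ℝ → Euc n := fun t => (φ t (y, v)).1
  let u : ℝ → Euc n := fun t => (φ t (y, v)).2
  have hc0 : c 0 = y := by simp [c, hφ.zero]
  have hu0 : u 0 = v := by simp [u, hφ.zero]
  have hc : ∀ t, HasDerivAt c (u t) t := hφ.hasDerivAt_fst (y, v)
  have hu := hφ.hasDerivAt_snd (y, v) 0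
  have hfc : ∀ t, 0 ≤ t → f (c t) = t ^ 2 * Q y v v := fun t ht =>
    riemDist_flow_zero hQ hmin hφ y v ht
  have hfd : ∀ t, HasDerivAt (fun s => f (c s)) (fderiv ℝ f (c t) (u t)) t := fun t =>
    ((hf.differentiable two_ne_zero (c t)).hasFDerivAt).comp_hasDerivAt t (hc t)
  -- At the minimum `y` the first differential vanishes, so the acceleration of the geodesic does
  -- not contribute to the second derivative of `f ∘ c`.
  have hcrit : fderiv ℝ f y = 0 := by
    have : IsLocalMin f y := Eventually.of_forall fun x => by
      simpa [f, riemDist_self hQ hmin y] using sq_nonneg _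
    exact this.fderiv_eq_zero
  -- The formula for `f ∘ c` is available only for `t ≥ 0`; one-sided derivatives determine the
  -- two-sided ones.
  have hval : ∀ t ∈ Ici (0 : ℝ), fderiv ℝ f (c t) (u t) = 2 * t * Q y v v := by
    intro t (ht : 0 ≤ t)
    have h1 : HasDerivAt (fun t : ℝ => t ^ 2 * Q y v v) (2 * t * Q y v v) t := by
      simpa using (hasDerivAt_pow 2 t).mul_const (Q y v v)
    have h2 : HasDerivWithinAt (fun s => f (c s)) (2 * t * Q y v v) (Ici t) t :=
      h1.hasDerivWithinAt.congr (fun s hs => hfc s (ht.trans hs)) (hfc t ht)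
    exact (uniqueDiffOn_Ici t t self_mem_Ici).eq_deriv _ (hfd t).hasDerivWithinAt h2
  have hD : HasDerivAt (fun t => fderiv ℝ f (c t) (u t)) (fderiv ℝ (fderiv ℝ f) y v v) 0 := by
    have h1 : HasFDerivAt (fderiv ℝ f) (fderiv ℝ (fderiv ℝ f) y) y :=
      ((hf.fderiv_right (m := 1) (by norm_num)).differentiable one_ne_zero y).hasFDerivAt
    have h2 : HasDerivAt (fun t => fderiv ℝ f (c t)) (fderiv ℝ (fderiv ℝ f) y (u 0)) 0 :=
      HasFDerivAt.comp_hasDerivAt_of_eq (0 : ℝ) h1 (hc 0) hc0.symm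
    refine (h2.clm_apply hu).congr_deriv ?_
    rw [hc0, hcrit, zero_apply, add_zero]
    change fderiv ℝ (fderiv ℝ f) y (u 0) (u 0) = _
    rw [hu0]
  have hD' : HasDerivWithinAt (fun t => fderiv ℝ f (c t) (u t)) (2 * Q y v v) (Ici 0) 0 := by
    have h1 : HasDerivAt (fun t : ℝ => 2 * t * Q y v v) (2 * Q y v v) 0 := by
      simpa using ((hasDerivAt_id (0 : ℝ)).const_mul 2).mul_const (Q y v v)
    exact h1.hasDerivWithinAt.congr hval (hval 0 self_mem_Ici)
  exact (uniqueDiffOn_Ici (0 : ℝ) 0 self_mem_Ici).eq_deriv _ hD.hasDerivWithinAt hD'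

/-- The squared distance to the initial point increases along a nonconstant geodesic. -/
theorem deriv_sq_riemDist_pos (hQ : IsRiemannianMetricOn 2 Q univ)
    (hmin : IsCompleteWithMinimizingGeodesics Q) {δ : ℝ → Euc n} {I : Set ℝ}
    (hδ : IsGeodesicOn Q univ δ I) {s₃ s₄ s : ℝ} (h₃ : s₃ ∈ I) (h₄ : s₄ ∈ I)
    (hne : δ s₃ ≠ δ s₄) (hs : s ∈ Ioo s₃ s₄) :
    0 < deriv (fun t => riemDist Q univ (δ t) (δ s₃) ^ 2) s := by
  obtain ⟨φ, hφ⟩ := exists_geodesicFlow hQ hmin.complete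
  obtain ⟨γ, hγ, heq⟩ := hmin.complete δ I ⟨s₃, h₃⟩ hδ
  let v := deriv γ s₃
  -- By uniqueness the complete extension is the flow line of its state at `s₃`, shifted in time.
  have hγφ : ∀ t, γ t = (φ (t - s₃) (γ s₃, v)).1 := by
    have h : (fun t => (γ (t + s₃), deriv γ (t + s₃))) = fun t => φ t (γ s₃, v) := by
      refine integralCurve_unique (contDiff_geodesicField hQ) (fun t => ?_) (hφ.hasDerivAt _)
        (by simp [hφ.zero, v])
      exact (hγ.integralCurve (mem_univ (t + s₃))).comp_add_const t s₃
    intro t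
    have h1 := congrArg Prod.fst (congrFun h (t - s₃))
    simpa using h1
  have hI : ∀ t ∈ Icc s₃ s₄, γ t = δ t := fun t ht => heq (hδ.ordConnected.out h₃ h₄ ht)
  have h34 : s₃ ≤ s₄ := (hs.1.trans hs.2).le
  have hdist : ∀ t ∈ Icc s₃ s₄, riemDist Q univ (δ t) (δ s₃) ^ 2 =
      (t - s₃) ^ 2 * Q (γ s₃) v v := by
    intro t ht
    rw [← hI t ht, ← hI s₃ (left_mem_Icc.2 h34), hγφ t]
    exact riemDist_flow_zero hQ hmin hφ _ _ (sub_nonneg.2 ht.1)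
  have hv : v ≠ 0 := by
    intro hv
    apply hne
    rw [← hI s₃ (left_mem_Icc.2 h34), ← hI s₄ (right_mem_Icc.2 h34), hγφ s₄, hv,
      flow_zero_velocity hQ hφ]
  have h1 : (fun t => riemDist Q univ (δ t) (δ s₃) ^ 2) =ᶠ[𝓝 s]
      fun t => (t - s₃) ^ 2 * Q (γ s₃) v v := by
    filter_upwards [Icc_mem_nhds hs.1 hs.2] with t ht using hdist t ht
  have h2 : HasDerivAt (fun t => (t - s₃) ^ 2 * Q (γ s₃) v v)
      (2 * (s - s₃) * Q (γ s₃) v v) s := by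
    simpa using (((hasDerivAt_id s).sub_const s₃).pow 2).mul_const (Q (γ s₃) v v)
  rw [h1.deriv_eq, h2.deriv]
  have h3 := hQ.pos (γ s₃) (mem_univ _) v hv
  have h4 := sub_pos.2 hs.1
  positivity

end SquaredDistance

/-! ### The metric of `Ξ` and the differential of `hperp` in a chart -/

section Chart

variable {m : ℕ} {k : WithTop ℕ∞} {Ξ : Type*} [TopologicalSpace Ξ]
  [ChartedSpace (EuclideanSpace ℝ (Fin m)) Ξ] [IsManifold (𝓡 m) 1 Ξ]

/-- The components of a Riemannian metric on a manifold in a chart. -/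
lemma exists_chart_metric
    (R : Bundle.ContMDiffRiemannianMetric (𝓡 m) k (EuclideanSpace ℝ (Fin m))
      (TangentSpace (𝓡 m) : Ξ → Type)) (ξ₀ : Ξ) :
    ∃ Rt : BilinField m, ContDiffAt ℝ k Rt (extChartAt (𝓡 m) ξ₀ ξ₀) ∧
      ∀ ξ ∈ (chartAt (EuclideanSpace ℝ (Fin m)) ξ₀).source, ∀ v w : TangentSpace (𝓡 m) ξ,
        R.inner ξ v w = Rt (extChartAt (𝓡 m) ξ₀ ξ)
          ((trivializationAt (Euc m) (TangentSpace (𝓡 m)) ξ₀).continuousLinearMapAt ℝ ξ v)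
          ((trivializationAt (Euc m) (TangentSpace (𝓡 m)) ξ₀).continuousLinearMapAt ℝ ξ w) := by
  let s : Ξ → Euc m →L[ℝ] Euc m →L[ℝ] ℝ := fun ξ =>
    (trivializationAt (Euc m →L[ℝ] Euc m →L[ℝ] ℝ)
      (fun x : Ξ => TangentSpace (𝓡 m) x →L[ℝ] TangentSpace (𝓡 m) x →L[ℝ] ℝ) ξ₀
      (Bundle.TotalSpace.mk' (Euc m →L[ℝ] Euc m →L[ℝ] ℝ) ξ (R.inner ξ))).2
  have hs : ContMDiffAt (𝓡 m) 𝓘(ℝ, Euc m →L[ℝ] Euc m →L[ℝ] ℝ) k s ξ₀ :=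
    (Bundle.contMDiffAt_section ξ₀).1 R.contMDiff.contMDiffAt
  refine ⟨fun ζ => s ((extChartAt (𝓡 m) ξ₀).symm ζ), ?_, fun ξ hξ v w => ?_⟩
  · have h1 := (contMDiffAt_iff.1 hs).2
    rw [extChartAt_model_space_eq_id, ModelWithCorners.range_eq_univ, contDiffWithinAt_univ] at h1
    exact h1
  · have hξ' : ξ ∈ (extChartAt (𝓡 m) ξ₀).source := by rwa [extChartAt_source]
    have hb : ξ ∈ (trivializationAt (Euc m) (TangentSpace (𝓡 m)) ξ₀).baseSet := hξ
    have h1 : s ξ = ContinuousLinearMap.inCoordinates (Euc m) (TangentSpace (𝓡 m))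
        (Euc m →L[ℝ] ℝ) (fun x : Ξ => TangentSpace (𝓡 m) x →L[ℝ] ℝ) ξ₀ ξ ξ₀ ξ (R.inner ξ) := rfl
    have h2 : ∀ y : TangentSpace (𝓡 m) ξ,
        (trivializationAt (Euc m) (TangentSpace (𝓡 m)) ξ₀).symm ξ
          ((trivializationAt (Euc m) (TangentSpace (𝓡 m)) ξ₀).continuousLinearMapAt ℝ ξ y) = y :=
      fun y => by
        have h3 := (trivializationAt (Euc m) (TangentSpace (𝓡 m)) ξ₀).symmL_continuousLinearMapAt
          (R := ℝ) hb y
        rw [Bundle.Trivialization.symmL_apply _ hb] at h3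
        exact h3
    dsimp only
    rw [(extChartAt (𝓡 m) ξ₀).left_inv hξ', h1, inCoordinates_apply_eq₂ hb hb (mem_univ _), h2, h2]
    simp

variable {n p : ℕ} {Ω : Set (Euc n)} {hperp : Euc n → Ξ}

/-- The differential of a map into a manifold, read in a chart. -/
lemma fderiv_extChartAt_comp {ξ₀ : Ξ} {x : Euc n}
    (hx : hperp x ∈ (chartAt (EuclideanSpace ℝ (Fin m)) ξ₀).source)
    (hd : MDifferentiableAt (𝓡 n) (𝓡 m) hperp x) (u : Euc n) :
    fderiv ℝ (fun y => extChartAt (𝓡 m) ξ₀ (hperp y)) x u =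
      (trivializationAt (Euc m) (TangentSpace (𝓡 m)) ξ₀).continuousLinearMapAt ℝ (hperp x)
        (mfderiv (𝓡 n) (𝓡 m) hperp x u) := by
  -- Over a chart domain the tangent trivialization is the differential of the chart, so the claim
  -- is the chain rule.
  rw [TangentBundle.continuousLinearMapAt_trivializationAt hx]
  have h1 := mfderiv_comp x (mdifferentiableAt_extChartAt hx) hd
  rw [← mfderiv_eq_fderiv]
  exact DFunLike.congr_fun h1 u

lemma pullback_productMetric_apply {Q : BilinField p} {h : Euc n → Euc p}
    (R : Bundle.ContMDiffRiemannianMetric (𝓡 m) k (EuclideanSpace ℝ (Fin m))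
      (TangentSpace (𝓡 m) : Ξ → Type)) {x : Euc n} (hh : DifferentiableAt ℝ h x)
    (hd : MDifferentiableAt (𝓡 n) (𝓡 m) hperp x) (u v : Euc n) :
    pullbackMetric (fun x' => (h x', hperp x')) (productMetric Q R) x u v =
      Q (h x) (fderiv ℝ h x u) (fderiv ℝ h x v) +
        R.inner (hperp x) (mfderiv (𝓡 n) (𝓡 m) hperp x u) (mfderiv (𝓡 n) (𝓡 m) hperp x v) := by
  have h1 : mfderiv (𝓡 n) ((𝓡 p).prod (𝓡 m)) (fun x' => (h x', hperp x')) x = _ :=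
    mfderiv_prodMk (I := 𝓡 n) (I' := 𝓡 p) (I'' := 𝓡 m) hh.mdifferentiableAt hd
  simp only [pullbackMetric, productMetric]
  rw [h1, ← mfderiv_eq_fderiv]
  rfl

end Chart

/-! ### Pullbacks of product metrics on Euclidean spaces -/

section Pullback

/-- `A` is injective on `ker B`, whose dimension is the rank of `A` by hypothesis; hence `A` already
attains its whole range on `ker B`. It serves with `dh` and `dg` in either role. -/
lemma exists_ker_apply_eq {V W W' : Type*} [AddCommGroup V] [Module ℝ V] [FiniteDimensional ℝ V]
    [AddCommGroup W] [Module ℝ W] [FiniteDimensional ℝ W] [AddCommGroup W'] [Module ℝ W']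
    (A : V →ₗ[ℝ] W) (B : V →ₗ[ℝ] W') (hinj : ∀ v, A v = 0 → B v = 0 → v = 0)
    (hrank : Module.finrank ℝ A.range + Module.finrank ℝ B.range = Module.finrank ℝ V) (v : V) :
    ∃ u, B u = 0 ∧ A u = A v := by
  have h1 : Function.Injective (A.domRestrict B.ker) := by
    rw [← LinearMap.ker_eq_bot, LinearMap.ker_eq_bot']
    rintro ⟨u, hu⟩ h
    exact Subtype.ext (hinj u h hu)
  have h2 := LinearMap.finrank_range_of_inj h1
  have h3 := B.finrank_range_add_finrank_ker
  have h4 : (A.domRestrict B.ker).range ≤ A.range := by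
    rintro _ ⟨u, rfl⟩
    exact ⟨u, rfl⟩
  have h5 := Submodule.eq_of_le_of_finrank_eq h4 (by omega)
  have h6 : A v ∈ (A.domRestrict B.ker).range := h5 ▸ ⟨v, rfl⟩
  obtain ⟨⟨u, hu⟩, huv⟩ := h6
  exact ⟨u, hu, huv⟩

variable {n p m : ℕ} {k : WithTop ℕ∞}

/-- Near `x₀`, the metric `P` is the pullback of the product of `Q` with a metric `R` on `ℝᵐ` via
`(h, g)`, an immersion with `g` of rank `n - p`. -/
structure IsLocalProduct (k : WithTop ℕ∞) (P : BilinField n) (Q : BilinField p)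
    (R : BilinField m) (h : Euc n → Euc p) (g : Euc n → Euc m) (x₀ : Euc n) : Prop where
  contDiffAt_left : ContDiffAt ℝ (k + 1) h x₀
  contDiffAt_right : ContDiffAt ℝ (k + 1) g x₀
  contDiffAt_metric_left : ContDiffAt ℝ k Q (h x₀)
  contDiffAt_metric_right : ContDiffAt ℝ k R (g x₀)
  symm_left : ∀ u v, Q (h x₀) u v = Q (h x₀) v u
  symm_right : ∀ u v, R (g x₀) u v = R (g x₀) v u
  pos_left : ∀ v, v ≠ 0 → 0 < Q (h x₀) v v
  pos_right : ∀ v, v ≠ 0 → 0 < R (g x₀) v v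
  eventually_eq : ∀ᶠ x in 𝓝 x₀, ∀ u v, P x u v =
    Q (h x) (fderiv ℝ h x u) (fderiv ℝ h x v) + R (g x) (fderiv ℝ g x u) (fderiv ℝ g x v)
  eq_zero : ∀ v, fderiv ℝ h x₀ v = 0 → fderiv ℝ g x₀ v = 0 → v = 0
  finrank_left : Module.finrank ℝ (fderiv ℝ h x₀ : Euc n →ₗ[ℝ] Euc p).range = p
  finrank_right : Module.finrank ℝ (fderiv ℝ g x₀ : Euc n →ₗ[ℝ] Euc m).range + p = n

/-- The pullback via `f` of a field `G` of bilinear forms, evaluated on constant vectors. -/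
lemma contDiffAt_pullback_apply {G : BilinField m} {f : Euc n → Euc m} {x : Euc n}
    (hf : ContDiffAt ℝ (k + 1) f x) (hG : ContDiffAt ℝ k G (f x)) (u v : Euc n) :
    ContDiffAt ℝ k (fun x => G (f x) (fderiv ℝ f x u) (fderiv ℝ f x v)) x := by
  have h1 : ContDiffAt ℝ k (fderiv ℝ f) x := hf.fderiv_right le_rfl
  have h2 : ContDiffAt ℝ k (fun x => G (f x)) x := hG.comp x (hf.of_le le_self_add)
  exact (h2.clm_apply (h1.clm_apply contDiffAt_const)).clm_apply (h1.clm_apply contDiffAt_const)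

lemma fderiv_pullback_apply {G : BilinField m} {f : Euc n → Euc m} {x : Euc n}
    (hf : ContDiffAt ℝ 2 f x) (hG : DifferentiableAt ℝ G (f x)) (u v w : Euc n) :
    fderiv ℝ (fun x => G (f x) (fderiv ℝ f x u) (fderiv ℝ f x v)) x w =
      fderiv ℝ G (f x) (fderiv ℝ f x w) (fderiv ℝ f x u) (fderiv ℝ f x v)
      + G (f x) (fderiv ℝ (fderiv ℝ f) x w u) (fderiv ℝ f x v)
      + G (f x) (fderiv ℝ f x u) (fderiv ℝ (fderiv ℝ f) x w v) := by
  have h1 : HasFDerivAt (fderiv ℝ f) (fderiv ℝ (fderiv ℝ f) x) x :=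
    ((hf.fderiv_right (m := 1) (by norm_num)).differentiableAt one_ne_zero).hasFDerivAt
  have h2 : HasFDerivAt (fun x => G (f x)) ((fderiv ℝ G (f x)).comp (fderiv ℝ f x)) x :=
    HasFDerivAt.comp (g := G) (f := f) x hG.hasFDerivAt
      (hf.differentiableAt two_ne_zero).hasFDerivAt
  have hc : ∀ u, HasFDerivAt (fun x => fderiv ℝ f x u) _ x := fun u =>
    h1.clm_apply (hasFDerivAt_const u x)
  rw [((h2.clm_apply (hc u)).clm_apply (hc v)).fderiv]
  simp
  ring

/-- The Christoffel symbols of the first kind of a pullback. -/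
lemma fderiv_pullback_firstKind {G : BilinField m} {f : Euc n → Euc m} {x : Euc n}
    (hf : ContDiffAt ℝ 2 f x) (hG : DifferentiableAt ℝ G (f x))
    (hsymm : ∀ u v, G (f x) u v = G (f x) v u) (u v w : Euc n) :
    (1 / 2 : ℝ) * (fderiv ℝ (fun x => G (f x) (fderiv ℝ f x u) (fderiv ℝ f x w)) x v
      + fderiv ℝ (fun x => G (f x) (fderiv ℝ f x v) (fderiv ℝ f x w)) x u
      - fderiv ℝ (fun x => G (f x) (fderiv ℝ f x u) (fderiv ℝ f x v)) x w) =
    firstKind G (f x) (fderiv ℝ f x u) (fderiv ℝ f x v) (fderiv ℝ f x w)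
      + G (f x) (fderiv ℝ (fderiv ℝ f) x u v) (fderiv ℝ f x w) := by
  have hs : IsSymmSndFDerivAt ℝ f x := hf.isSymmSndFDerivAt (by simp)
  simp only [fderiv_pullback_apply hf hG, firstKind]
  -- Of the six terms with second derivatives of `f`, four cancel in pairs by symmetry of `D²f` and
  -- `G`, and two coincide.
  rw [hs v u, hs w u, hs w v, hsymm (fderiv ℝ (fderiv ℝ f) x u w) (fderiv ℝ f x v)]
  ring

variable {P : BilinField n} {Q : BilinField p} {R : BilinField m} {h : Euc n → Euc p}
  {g : Euc n → Euc m} {x₀ : Euc n}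

namespace IsLocalProduct

lemma apply_eq (H : IsLocalProduct k P Q R h g x₀) (u v : Euc n) : P x₀ u v =
    Q (h x₀) (fderiv ℝ h x₀ u) (fderiv ℝ h x₀ v) + R (g x₀) (fderiv ℝ g x₀ u) (fderiv ℝ g x₀ v) :=
  H.eventually_eq.self_of_nhds u v

lemma contDiffAt_apply (H : IsLocalProduct k P Q R h g x₀) (u v : Euc n) :
    ContDiffAt ℝ k (fun x => P x u v) x₀ := by
  refine ((contDiffAt_pullback_apply H.contDiffAt_left H.contDiffAt_metric_left u v).add
    (contDiffAt_pullback_apply H.contDiffAt_right H.contDiffAt_metric_right u v)).congr_of_eventuallyEq ?_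
  filter_upwards [H.eventually_eq] with x hx using hx u v

lemma symm (H : IsLocalProduct k P Q R h g x₀) (u v : Euc n) : P x₀ u v = P x₀ v u := by
  rw [H.apply_eq, H.apply_eq, H.symm_left, H.symm_right]

lemma nonneg_left (H : IsLocalProduct k P Q R h g x₀) (v : Euc p) : 0 ≤ Q (h x₀) v v := by
  by_cases hv : v = 0
  · simp [hv]
  · exact (H.pos_left v hv).le

lemma nonneg_right (H : IsLocalProduct k P Q R h g x₀) (v : Euc m) : 0 ≤ R (g x₀) v v := by
  by_cases hv : v = 0
  · simp [hv]
  · exact (H.pos_right v hv).le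

lemma pos (H : IsLocalProduct k P Q R h g x₀) (v : Euc n) (hv : v ≠ 0) : 0 < P x₀ v v := by
  rw [H.apply_eq]
  by_cases h1 : fderiv ℝ h x₀ v = 0
  · exact add_pos_of_nonneg_of_pos (H.nonneg_left _)
      (H.pos_right _ fun h2 => hv (H.eq_zero v h1 h2))
  · exact add_pos_of_pos_of_nonneg (H.pos_left _ h1) (H.nonneg_right _)

/-- Choose `u ∈ ker dh` with `dg u = dg v`. Orthogonality `P(u, v) = 0` then says `R(dg v, dg v) =
0`, so only the `Q` term of `P(v, v)` survives. -/
lemma riemannianSubmersion (H : IsLocalProduct k P Q R h g x₀) {v : Euc n}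
    (hv : v ∈ orthogonalDistribution P h x₀) :
    Q (h x₀) (fderiv ℝ h x₀ v) (fderiv ℝ h x₀ v) = P x₀ v v := by
  obtain ⟨u, hu, huv⟩ := exists_ker_apply_eq (fderiv ℝ g x₀ : Euc n →ₗ[ℝ] Euc m)
    (fderiv ℝ h x₀ : Euc n →ₗ[ℝ] Euc p) (fun v h1 h2 => H.eq_zero v h2 h1)
    (by rw [H.finrank_left, H.finrank_right, finrank_euclideanSpace_fin]) v
  have hu' : fderiv ℝ h x₀ u = 0 := hu
  have huv' : fderiv ℝ g x₀ u = fderiv ℝ g x₀ v := huv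
  have h1 := hv u hu'
  rw [H.apply_eq, hu', huv'] at h1
  rw [H.apply_eq]
  simp at h1
  rw [h1, add_zero]

/-- The second fundamental form of `h` vanishes. -/
lemma chrVec_eq (H : IsLocalProduct k P Q R h g x₀) (hk : 1 ≤ k)
    (hP : DifferentiableAt ℝ P x₀) (u v : Euc n) :
    fderiv ℝ h x₀ (chrVec P x₀ u v) = fderiv ℝ (fderiv ℝ h) x₀ u v
      + chrVec Q (h x₀) (fderiv ℝ h x₀ u) (fderiv ℝ h x₀ v) := by
  have hk0 : k ≠ 0 := (zero_lt_one.trans_le hk).ne'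
  have hk2 : (2 : WithTop ℕ∞) ≤ k + 1 := by
    rw [← one_add_one_eq_two]
    gcongr
  have hh2 := H.contDiffAt_left.of_le hk2
  have hg2 := H.contDiffAt_right.of_le hk2
  have hQd := H.contDiffAt_metric_left.differentiableAt hk0
  have hRd := H.contDiffAt_metric_right.differentiableAt hk0
  set S := fderiv ℝ (fderiv ℝ h) x₀ u v
    + chrVec Q (h x₀) (fderiv ℝ h x₀ u) (fderiv ℝ h x₀ v) with hS
  have hPd : ∀ u v w, fderiv ℝ P x₀ w u v =
      fderiv ℝ (fun x => Q (h x) (fderiv ℝ h x u) (fderiv ℝ h x v)) x₀ w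
      + fderiv ℝ (fun x => R (g x) (fderiv ℝ g x u) (fderiv ℝ g x v)) x₀ w := by
    intro u v w
    have h1 : fderiv ℝ (fun x => P x u v) x₀ w = fderiv ℝ P x₀ w u v := by
      rw [((hP.hasFDerivAt.clm_apply (hasFDerivAt_const u x₀)).clm_apply
        (hasFDerivAt_const v x₀)).fderiv]
      simp
    have h2 : (fun x => P x u v) =ᶠ[𝓝 x₀] fun x =>
        Q (h x) (fderiv ℝ h x u) (fderiv ℝ h x v) + R (g x) (fderiv ℝ g x u) (fderiv ℝ g x v) := by
      filter_upwards [H.eventually_eq] with x hx using hx u v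
    rw [← h1, h2.fderiv_eq, fderiv_fun_add
      ((contDiffAt_pullback_apply H.contDiffAt_left H.contDiffAt_metric_left u v).differentiableAt hk0)
      ((contDiffAt_pullback_apply H.contDiffAt_right H.contDiffAt_metric_right u v).differentiableAt hk0)]
    rfl
  -- Against `w ∈ ker dg` the `R` part vanishes both in `P` and in its Christoffel symbols of the
  -- first kind.
  have key : ∀ w, fderiv ℝ g x₀ w = 0 →
      Q (h x₀) (fderiv ℝ h x₀ (chrVec P x₀ u v) - S) (fderiv ℝ h x₀ w) = 0 := by
    intro w hw
    have h1 := apply_chrVec hP H.symm H.pos u v w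
    have h2 := fderiv_pullback_firstKind hh2 hQd H.symm_left u v w
    have h3 := fderiv_pullback_firstKind hg2 hRd H.symm_right u v w
    have h4 := apply_chrVec hQd H.symm_left H.pos_left (fderiv ℝ h x₀ u) (fderiv ℝ h x₀ v)
      (fderiv ℝ h x₀ w)
    rw [hw] at h3
    have h5 : firstKind R (g x₀) (fderiv ℝ g x₀ u) (fderiv ℝ g x₀ v) 0 = 0 := by simp [firstKind]
    rw [h5, map_zero, add_zero] at h3
    rw [H.apply_eq, hw, map_zero, add_zero, firstKind, hPd, hPd, hPd] at h1
    rw [map_sub, sub_apply, hS, map_add, add_apply, h4, h1]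
    linarith
  -- As `dh` maps `ker dg` onto `ℝᵖ`, the test vector can be chosen with `dh w` equal to the defect
  -- itself; positivity of `Q` makes the defect zero.
  obtain ⟨w, hw0, hw⟩ : ∃ w, fderiv ℝ g x₀ w = 0 ∧
      fderiv ℝ h x₀ w = fderiv ℝ h x₀ (chrVec P x₀ u v) - S := by
    have hsurj : (fderiv ℝ h x₀ : Euc n →ₗ[ℝ] Euc p).range = ⊤ :=
      Submodule.eq_top_of_finrank_eq (by rw [H.finrank_left, finrank_euclideanSpace_fin])
    obtain ⟨w', hw'⟩ := LinearMap.range_eq_top.1 hsurj (fderiv ℝ h x₀ (chrVec P x₀ u v) - S)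
    obtain ⟨w, hw0, hw⟩ := exists_ker_apply_eq (fderiv ℝ h x₀ : Euc n →ₗ[ℝ] Euc p)
      (fderiv ℝ g x₀ : Euc n →ₗ[ℝ] Euc m) H.eq_zero
      (by rw [H.finrank_left, add_comm, H.finrank_right, finrank_euclideanSpace_fin]) w'
    exact ⟨w, hw0, hw.trans hw'⟩
  have h1 := key w hw0
  rw [hw] at h1
  by_contra hne
  exact (H.pos_left _ (sub_ne_zero.2 hne)).ne' h1

end IsLocalProduct

end Pullback

/-! ### Reduction of the manifold data to a local product -/

section LocalProduct

variable {n p m : ℕ} {k : WithTop ℕ∞}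

lemma eq_zero_of_finrank_range_eq {V W : Type*} [AddCommGroup V] [Module ℝ V]
    [FiniteDimensional ℝ V] [AddCommGroup W] [Module ℝ W] (A : V →ₗ[ℝ] W)
    (h : Module.finrank ℝ A.range = Module.finrank ℝ V) {v : V} (hv : A v = 0) : v = 0 := by
  have h1 := A.finrank_range_add_finrank_ker
  have h2 : A.ker = ⊥ := Submodule.finrank_eq_zero.1 (by omega)
  exact (Submodule.mem_bot ℝ).1 (h2 ▸ LinearMap.mem_ker.2 hv)

lemma finrank_range_eq_of_ker_eq {V W W' : Type*} [AddCommGroup V] [Module ℝ V]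
    [FiniteDimensional ℝ V] [AddCommGroup W] [Module ℝ W] [AddCommGroup W'] [Module ℝ W']
    (A : V →ₗ[ℝ] W) (B : V →ₗ[ℝ] W') (h : A.ker = B.ker) :
    Module.finrank ℝ A.range = Module.finrank ℝ B.range := by
  have h1 := A.finrank_range_add_finrank_ker
  have h2 := B.finrank_range_add_finrank_ker
  rw [h] at h1
  omega

/-- Take the chart at `hperp x₀`. The tangent trivialization is invertible on the fibre over `hperp
x₀`, so the chart expression of `hperp` has the same kernel, hence rank, and `R` stays symmetric and
positive in coordinates. -/
lemma exists_isLocalProduct {Ω : Set (Euc n)} (hΩ : IsOpen Ω) {h : Euc n → Euc p}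
    (hh : ContDiffOn ℝ (k + 1) h Ω) (hsub : IsSubmersionOn h Ω) {Q : BilinField p}
    (hQ : IsRiemannianMetricOn k Q univ)
    {Ξ : Type*} [TopologicalSpace Ξ] [ChartedSpace (EuclideanSpace ℝ (Fin m)) Ξ]
    [IsManifold (𝓡 m) 1 Ξ]
    (R : Bundle.ContMDiffRiemannianMetric (𝓡 m) k (EuclideanSpace ℝ (Fin m))
      (TangentSpace (𝓡 m) : Ξ → Type))
    {hperp : Euc n → Ξ} (hhperp : ContMDiffOn (𝓡 n) (𝓡 m) (k + 1) hperp Ω)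
    (hrank : ∀ x ∈ Ω, Module.finrank ℝ (mfderiv (𝓡 n) (𝓡 m) hperp x).range + p = n)
    (hrankθ : ∀ x ∈ Ω, Module.finrank ℝ
      (mfderiv (𝓡 n) ((𝓡 p).prod (𝓡 m)) (fun x' => (h x', hperp x')) x).range = n)
    {P : BilinField n} (hP : ∀ x ∈ Ω, P x = pullbackMetric (fun x' => (h x', hperp x'))
      (productMetric Q R) x) {x₀ : Euc n} (hx₀ : x₀ ∈ Ω) :
    ∃ (g : Euc n → Euc m) (Rt : BilinField m), IsLocalProduct k P Q Rt h g x₀ := by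
  have hk : k + 1 ≠ 0 := by simp
  obtain ⟨Rt, hRt, hRt'⟩ := exists_chart_metric R (hperp x₀)
  have hhd : ∀ x ∈ Ω, DifferentiableAt ℝ h x := fun x hx =>
    (hh.contDiffAt (hΩ.mem_nhds hx)).differentiableAt hk
  have hsm : ∀ x ∈ Ω, ContMDiffAt (𝓡 n) (𝓡 m) (k + 1) hperp x := fun x hx =>
    hhperp.contMDiffAt (hΩ.mem_nhds hx)
  have hmd : ∀ x ∈ Ω, MDifferentiableAt (𝓡 n) (𝓡 m) hperp x := fun x hx =>
    (hsm x hx).mdifferentiableAt hk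
  set e := trivializationAt (Euc m) (TangentSpace (𝓡 m)) (hperp x₀)
  have hb : hperp x₀ ∈ e.baseSet := mem_chart_source (Euc m) (hperp x₀)
  have hg : ∀ u, fderiv ℝ (fun y => extChartAt (𝓡 m) (hperp x₀) (hperp y)) x₀ u =
      e.continuousLinearMapAt ℝ (hperp x₀) (mfderiv (𝓡 n) (𝓡 m) hperp x₀ u) :=
    fderiv_extChartAt_comp (mem_chart_source (Euc m) (hperp x₀)) (hmd x₀ hx₀)
  have hker : ∀ u, fderiv ℝ (fun y => extChartAt (𝓡 m) (hperp x₀) (hperp y)) x₀ u = 0 ↔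
      mfderiv (𝓡 n) (𝓡 m) hperp x₀ u = 0 := by
    intro u
    rw [hg]
    refine ⟨fun h0 => ?_, fun h0 => by rw [h0, map_zero]⟩
    have h1 := e.symmL_continuousLinearMapAt (R := ℝ) hb (mfderiv (𝓡 n) (𝓡 m) hperp x₀ u)
    rw [h0, map_zero] at h1
    exact h1.symm
  have hsurj : ∀ v : Euc m, e.continuousLinearMapAt ℝ (hperp x₀) (e.symmL ℝ (hperp x₀) v) = v :=
    e.continuousLinearMapAt_symmL hb
  refine ⟨fun y => extChartAt (𝓡 m) (hperp x₀) (hperp y), Rt,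
    ⟨hh.contDiffAt (hΩ.mem_nhds hx₀), ?_, (contDiffOn_univ.1 hQ.contDiffOn).contDiffAt, hRt,
    hQ.symm _ (mem_univ _), fun u v => ?_, hQ.pos _ (mem_univ _), fun v hv => ?_, ?_, fun v h1 h2 => ?_,
    hsub x₀ hx₀, ?_⟩⟩
  · have h1 := (contMDiffAt_iff.1 (hsm x₀ hx₀)).2
    rw [extChartAt_model_space_eq_id, ModelWithCorners.range_eq_univ, contDiffWithinAt_univ] at h1
    exact h1
  · have h1 := hRt' _ (mem_chart_source (Euc m) (hperp x₀)) (e.symmL ℝ (hperp x₀) u)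
      (e.symmL ℝ (hperp x₀) v)
    have h2 := hRt' _ (mem_chart_source (Euc m) (hperp x₀)) (e.symmL ℝ (hperp x₀) v)
      (e.symmL ℝ (hperp x₀) u)
    rw [hsurj, hsurj] at h1 h2
    rw [← h1, ← h2, R.symm]
  · have h1 := hRt' _ (mem_chart_source (Euc m) (hperp x₀)) (e.symmL ℝ (hperp x₀) v)
      (e.symmL ℝ (hperp x₀) v)
    rw [hsurj] at h1
    rw [← h1]
    refine R.pos _ _ fun h0 => hv ?_
    rw [← hsurj v, h0, map_zero]
  · have h1 : ∀ᶠ x in 𝓝 x₀, hperp x ∈ (chartAt (Euc m) (hperp x₀)).source :=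
      (hmd x₀ hx₀).continuousAt.eventually_mem
        ((chartAt (Euc m) (hperp x₀)).open_source.mem_nhds (mem_chart_source _ _))
    filter_upwards [h1, hΩ.mem_nhds hx₀] with x hx hxΩ u v
    rw [hP x hxΩ, pullback_productMetric_apply R (hhd x hxΩ) (hmd x hxΩ), hRt' _ hx,
      fderiv_extChartAt_comp hx (hmd x hxΩ), fderiv_extChartAt_comp hx (hmd x hxΩ)]
  · let A : Euc n →L[ℝ] Euc p × Euc m :=
      mfderiv (𝓡 n) ((𝓡 p).prod (𝓡 m)) (fun x' => (h x', hperp x')) x₀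
    have hA : mfderiv (𝓡 n) ((𝓡 p).prod (𝓡 m)) (fun x' => (h x', hperp x')) x₀ = _ :=
      mfderiv_prodMk (I := 𝓡 n) (I' := 𝓡 p) (I'' := 𝓡 m) (hhd x₀ hx₀).mdifferentiableAt
        (hmd x₀ hx₀)
    refine eq_zero_of_finrank_range_eq (A : Euc n →ₗ[ℝ] Euc p × Euc m)
      ((hrankθ x₀ hx₀).trans finrank_euclideanSpace_fin.symm) ?_
    have hAv : A v = (mfderiv (𝓡 n) (𝓡 p) h x₀ v, mfderiv (𝓡 n) (𝓡 m) hperp x₀ v) :=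
      DFunLike.congr_fun hA v
    refine hAv.trans (Prod.ext ?_ ((hker v).1 h2))
    exact (DFunLike.congr_fun mfderiv_eq_fderiv v).trans h1
  · let B : Euc n →L[ℝ] Euc m := mfderiv (𝓡 n) (𝓡 m) hperp x₀
    have h1 : Module.finrank ℝ (B : Euc n →ₗ[ℝ] Euc m).range + p = n := hrank x₀ hx₀
    refine (congrArg (· + p) (finrank_range_eq_of_ker_eq _ _ ?_)).trans h1
    ext u
    exact hker u

end LocalProduct

/-! ### Conclusions for `P` and for Condition A3 -/

section Main

variable {n p : ℕ} {k : WithTop ℕ∞} {P : BilinField n} {Q : BilinField p} {h : Euc n → Euc p}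
  {Ω : Set (Euc n)}

lemma IsRiemannianMetricOn.of_isLocalProduct {m : ℕ} (hP : ∀ x ∈ Ω,
    ∃ (g : Euc n → Euc m) (R : BilinField m), IsLocalProduct k P Q R h g x) :
    IsRiemannianMetricOn k P Ω where
  contDiffOn := contDiffOn_clm_apply.2 fun u => contDiffOn_clm_apply.2 fun v x hx => by
    obtain ⟨g, R, H⟩ := hP x hx
    exact (H.contDiffAt_apply u v).contDiffWithinAt
  symm x hx := by
    obtain ⟨g, R, H⟩ := hP x hx
    exact H.symm
  pos x hx := by
    obtain ⟨g, R, H⟩ := hP x hx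
    exact H.pos

/-- Turns the coordinate expression into the `i`-th component of a vector identity, the form in
which `IsLocalProduct.chrVec_eq` applies. -/
lemma secondFundamentalForm_eq {x : Euc n} (hh : ContDiffAt ℝ 2 h x) (i : Fin p) (a b : Fin n) :
    secondFundamentalForm P Q h x i a b =
      (fderiv ℝ (fderiv ℝ h) x (stdVec a) (stdVec b)
        - fderiv ℝ h x (chrVec P x (stdVec a) (stdVec b))
        + chrVec Q (h x) (fderiv ℝ h x (stdVec a)) (fderiv ℝ h x (stdVec b))) i := by
  have hd : ∀ᶠ y in 𝓝 x, DifferentiableAt ℝ h y := by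
    filter_upwards [hh.eventually (by simp)] with y hy using hy.differentiableAt two_ne_zero
  have h1 : ∀ j c, ∀ᶠ y in 𝓝 x, partialDeriv c (fun x' => h x' j) y = fderiv ℝ h y (stdVec c) j := by
    intro j c
    filter_upwards [hd] with y hy
    have := ((EuclideanSpace.proj (𝕜 := ℝ) j).hasFDerivAt.comp y hy.hasFDerivAt).fderiv
    exact DFunLike.congr_fun this (stdVec c)
  have h2 : HasFDerivAt (fderiv ℝ h) (fderiv ℝ (fderiv ℝ h) x) x :=
    ((hh.fderiv_right (m := 1) (by norm_num)).differentiableAt one_ne_zero).hasFDerivAt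
  have h3 : partialDeriv a (partialDeriv b fun x' => h x' i) x =
      fderiv ℝ (fderiv ℝ h) x (stdVec a) (stdVec b) i := by
    have h4 : partialDeriv b (fun x' => h x' i) =ᶠ[𝓝 x] fun y => fderiv ℝ h y (stdVec b) i := h1 i b
    rw [partialDeriv, h4.fderiv_eq]
    have h5 := ((EuclideanSpace.proj (𝕜 := ℝ) i).hasFDerivAt.comp x
      (h2.clm_apply (hasFDerivAt_const (stdVec b) x))).fderiv
    refine (DFunLike.congr_fun h5 (stdVec a)).trans ?_
    simp
  have h6 : ∀ w : Euc n, fderiv ℝ h x w i = ∑ c, w c * fderiv ℝ h x (stdVec c) i := by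
    intro w
    conv_lhs => rw [← sum_smul_stdVec w]
    simp [map_sum]
  rw [secondFundamentalForm, h3]
  simp only [fun j c => (h1 j c).self_of_nhds]
  simp only [PiLp.add_apply, PiLp.sub_apply]
  rw [h6 (chrVec P x _ _), chrVec_apply Q]
  simp only [chrVec_stdVec]

/-- A map whose second fundamental form vanishes sends geodesics to geodesics. -/
lemma IsGeodesicOn.comp_of_chrVec_eq (hΩ : IsOpen Ω) (hh : ContDiffOn ℝ 2 h Ω)
    (hQ : IsRiemannianMetricOn 2 Q univ)
    (hII : ∀ x ∈ Ω, ∀ u v, fderiv ℝ h x (chrVec P x u v) = fderiv ℝ (fderiv ℝ h) x u v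
      + chrVec Q (h x) (fderiv ℝ h x u) (fderiv ℝ h x v))
    {γ : ℝ → Euc n} {I : Set ℝ} (hγ : IsGeodesicOn P Ω γ I) :
    IsGeodesicOn Q univ (fun s => h (γ s)) I := by
  refine isGeodesicOn_of_integralCurve (z := fun s => (h (γ s), fderiv ℝ h (γ s) (deriv γ s)))
    hQ hγ.isOpen hγ.ordConnected fun s hs => ?_
  have hx := hγ.mapsTo hs
  have hh2 := hh.contDiffAt (hΩ.mem_nhds hx)
  have h1 : HasFDerivAt h (fderiv ℝ h (γ s)) (γ s) :=
    (hh2.differentiableAt two_ne_zero).hasFDerivAt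
  have h2 : HasFDerivAt (fderiv ℝ h) (fderiv ℝ (fderiv ℝ h) (γ s)) (γ s) :=
    ((hh2.fderiv_right (m := 1) (by norm_num)).differentiableAt one_ne_zero).hasFDerivAt
  have h3 := HasFDerivAt.comp_hasDerivAt (l := h) s h1 (hγ.hasDerivAt hs)
  -- The derivative of `dh γ'` is `D²h(γ', γ') - dh Γ_P(γ', γ')`, which `hII` turns into `-Γ_Q(dh
  -- γ', dh γ')`.
  have h4 := (HasFDerivAt.comp_hasDerivAt (l := fderiv ℝ h) s h2 (hγ.hasDerivAt hs)).clm_apply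
    (hγ.hasDerivAt_deriv hs)
  refine (h3.prodMk h4).congr_deriv (Prod.ext rfl ?_)
  simp only [Function.comp_apply, map_neg, hII _ hx, geodesicField]
  abel

lemma conditionA3_of_chrVec_eq (hΩ : IsOpen Ω) (hh : ContDiffOn ℝ 2 h Ω)
    (hQ : IsRiemannianMetricOn 2 Q univ) (hmin : IsCompleteWithMinimizingGeodesics Q)
    (hII : ∀ x ∈ Ω, ∀ u v, fderiv ℝ h x (chrVec P x u v) = fderiv ℝ (fderiv ℝ h) x u v
      + chrVec Q (h x) (fderiv ℝ h x u) (fderiv ℝ h x v)) :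
    ConditionA3 P Ω h (fun y₁ y₂ => riemDist Q univ y₁ y₂ ^ 2) where
  contDiff := contDiff_sq_riemDist hQ hmin
  nonneg _ _ := sq_nonneg _
  eq_zero y _ := by simp [riemDist_self hQ hmin y]
  hessian_pos y _ v hv := by
    rw [fderiv_fderiv_sq_riemDist hQ hmin]
    exact mul_pos two_pos (hQ.pos y (mem_univ y) v hv)
  monotone γ I hγ _ s₃ h₃ s₄ h₄ _ hne s hs :=
    deriv_sq_riemDist_pos hQ hmin (hγ.comp_of_chrVec_eq hΩ hh hQ hII) h₃ h₄ hne hs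

end Main

end RiemObs

end

theorem mainTheorem1 {n p m q : ℕ} {k : WithTop ℕ∞} (hk : 2 ≤ k)
    (Ω : Set (EuclideanSpace ℝ (Fin n))) (hΩ : IsOpen Ω)
    (h : EuclideanSpace ℝ (Fin n) → EuclideanSpace ℝ (Fin p))
    (hh : ContDiffOn ℝ (k + 1) h Ω) (hsub : RiemObs.IsSubmersionOn h Ω)
    (Q : EuclideanSpace ℝ (Fin p) →
      EuclideanSpace ℝ (Fin p) →L[ℝ] EuclideanSpace ℝ (Fin p) →L[ℝ] ℝ)
    (hQ : RiemObs.IsRiemannianMetricOn k Q Set.univ)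
    (hQmin : RiemObs.IsCompleteWithMinimizingGeodesics Q)
    {Ξ : Type*} [TopologicalSpace Ξ] [ChartedSpace (EuclideanSpace ℝ (Fin m)) Ξ]
    [IsManifold (𝓡 m) 1 Ξ] [IsManifold (𝓡 m) (k + 1) Ξ] (hm : m + p = n + q)
    (R : Bundle.ContMDiffRiemannianMetric (𝓡 m) k (EuclideanSpace ℝ (Fin m))
      (TangentSpace (𝓡 m) : Ξ → Type))
    (hperp : EuclideanSpace ℝ (Fin n) → Ξ)
    (hhperp : ContMDiffOn (𝓡 n) (𝓡 m) (k + 1) hperp Ω)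
    (hrank : ∀ x ∈ Ω, Module.finrank ℝ (mfderiv (𝓡 n) (𝓡 m) hperp x).range + p = n)
    (hrankθ : ∀ x ∈ Ω, Module.finrank ℝ
      (mfderiv (𝓡 n) ((𝓡 p).prod (𝓡 m)) (fun x' => (h x', hperp x')) x).range = n)
    (P : EuclideanSpace ℝ (Fin n) →
      EuclideanSpace ℝ (Fin n) →L[ℝ] EuclideanSpace ℝ (Fin n) →L[ℝ] ℝ)
    (hP : ∀ x ∈ Ω, P x = RiemObs.pullbackMetric (fun x' => (h x', hperp x'))
      (RiemObs.productMetric Q R) x) :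
    RiemObs.IsRiemannianMetricOn k P Ω ∧
    RiemObs.IsRiemannianSubmersionOn P Q h Ω ∧
    (∀ x ∈ Ω, ∀ i a b, RiemObs.secondFundamentalForm P Q h x i a b = 0) ∧
    RiemObs.ConditionA3 P Ω h (fun y₁ y₂ => RiemObs.riemDist Q Set.univ y₁ y₂ ^ 2) := by
  have H : ∀ x ∈ Ω, ∃ (g : RiemObs.Euc n → RiemObs.Euc m) (Rt : RiemObs.BilinField m),
      RiemObs.IsLocalProduct k P Q Rt h g x := fun x hx =>
    RiemObs.exists_isLocalProduct hΩ hh hsub hQ R hhperp hrank hrankθ hP hx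
  have hk1 : 1 ≤ k := le_trans (by norm_num) hk
  have hPk := RiemObs.IsRiemannianMetricOn.of_isLocalProduct H
  have hII : ∀ x ∈ Ω, ∀ u v, fderiv ℝ h x (RiemObs.chrVec P x u v) =
      fderiv ℝ (fderiv ℝ h) x u v
        + RiemObs.chrVec Q (h x) (fderiv ℝ h x u) (fderiv ℝ h x v) := fun x hx u v => by
    obtain ⟨g, Rt, hx'⟩ := H x hx
    exact hx'.chrVec_eq hk1 (hPk.differentiableAt (zero_lt_one.trans_le hk1).ne' hΩ hx) u v
  have hh2 : ContDiffOn ℝ 2 h Ω := hh.of_le (hk.trans le_self_add)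
  refine ⟨hPk, ⟨hsub, fun x hx v hv => ?_⟩, fun x hx i a b => ?_,
    RiemObs.conditionA3_of_chrVec_eq hΩ hh2 ⟨hQ.contDiffOn.of_le hk, hQ.symm, hQ.pos⟩ hQmin hII⟩
  · obtain ⟨g, Rt, hx⟩ := H x hx
    exact hx.riemannianSubmersion hv
  · rw [RiemObs.secondFundamentalForm_eq (hh2.contDiffAt (hΩ.mem_nhds hx)), hII x hx]
    simp
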